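/- Let $d\ge 1$ and $\mathscr D=\{1,\dots,d\}$. An environment is a sequence $\omega=(P_n,Q_n,R_n)_{n\in\mathbb Z}$ of triples of nonnegative $d\times d$ matrices such that each $P_n+Q_n+R_n$ is stochastic; $\Omega$ is the space of environments with its natural $\sigma$-algebra, $\theta$ is the shift $(\theta\omega)_n=\omega_{n+1}$, and $P$ is a probability measure on $\Omega$. Given $\omega$ and a probability vector $\mu_\omega$ on $\mathscr D$ (depending measurably on $\omega$), let $P^\mu_\omega$ be the law of the Markov chain $X_t=(\xi_t,Y_t)$ on $\mathbb Z\times\mathscr D$ that moves from $(n,i)$ to $(n+1,j)$, $(n,j)$, $(n-1,j)$ with probability $P_n(i,j)$, $R_n(i,j)$, $Q_n(i,j)$ and starts from $(0,Y_0)$ with $Y_0\sim\mu_\omega$; let $\mathbb P^\mu(F\times G)=\int_F P^\mu_\omega(G)\,P(d\omega)$ be the annealed law, $\mathbb E$ its expectation. Assume Condition C: $P$ is $\theta$-invariant and ergodic; with $\|A\|=\max_i\sum_j|a(i,j)|$, for all $n$, $E\log(1-\|R_n+P_n\|)^{-1}<\infty$ and $E\log(1-\|R_n+Q_n\|)^{-1}<\infty$;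 for all $n$, $P$-a.s. for all $j$, $\sum_iQ_n(i,j)>0$ and $\sum_iP_n(i,j)>0$; and with positive $P$-probability all sites of layer $0$ can be reached from one another with positive probability. Assume also that $\mu_\omega=\mathbf y_{-1}(\omega)$ for $P$-a.e. $\omega$ (with $\mathbf y_{-1}$ as below), that $\xi_t\to+\infty$ $\mathbb P^\mu$-a.s., and that $v_p:=1/\mathbb E T_1>0$, where $T_1=\inf\{t:\xi_t=1\}$. Here $(\zeta_n)_{n\in\mathbb Z}$ is the sequence of stochastic matrices with $\zeta_n=(I-Q_n\zeta_{n-1}-R_n)^{-1}P_n$ for all $n$, and $\mathbf y_n=\lim_{a\to-\infty}\mathbf u_a\zeta_a\zeta_{a+1}\cdots\zeta_n$ for arbitrary probability row vectors $\mathbf u_a$. Put $\widetilde u_n=(I-Q_n\zeta_{n-1}-R_n)^{-1}$ and $A_n=(I-Q_n\zeta_{n-1}-R_n)^{-1}Q_n$. For measurable $B\subseteq\Omega$ and $i\in\mathscr D$ let $$Q(B,i)=v_p\,\mathbb E\Big(\sum_{n=0}^{T_1-1}\mathbf 1\{\theta^{\xi_n}\omega\in B,\ Y_n=i\}\Big),\qquad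 Q_i(B)=Q(B,i),\qquad \overline Q(B)=\sum_{i\in\mathscr D}Q(B,i).$$ Then for $P$-a.e. $\omega$ the sequence $(\zeta_n)$ exists and is unique, the limits $\mathbf y_n$ exist and do not depend on $(\mathbf u_a)$, and the matrix series below converges; each $Q_i$ and $\overline Q$ is absolutely continuous with respect to $P$; and $P$-a.s. $$\frac{dQ_i}{dP}=v_p\,\big[\mu_\omega\big(\widetilde u_0+\zeta_0A_1\widetilde u_0+\zeta_0\zeta_1A_2A_1\widetilde u_0+\cdots\big)\big](i),$$ $$\frac{d\overline Q}{dP}=v_p\,\big[\mu_\omega\big(\widetilde u_0+\zeta_0A_1\widetilde u_0+\zeta_0\zeta_1A_2A_1\widetilde u_0+\cdots\big)\big]\mathbf 1 .$$ -/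

import Mathlib

open MeasureTheory ProbabilityTheory Filter Topology
open scoped ENNReal Matrix

noncomputable section

namespace StripRWRE

/-! ### Environments -/

/-- The transition data of one layer: nonnegative `d × d` matrices `P` (one layer to the right),
`Q` (one layer to the left), `R` (same layer) whose sum is a stochastic matrix. -/
structure Site (d : ℕ) where
  P : Matrix (Fin d) (Fin d) ℝ
  Q : Matrix (Fin d) (Fin d) ℝ
  R : Matrix (Fin d) (Fin d) ℝ
  P_nonneg : ∀ i j, 0 ≤ P i j
  Q_nonneg : ∀ i j, 0 ≤ Q i j
  R_nonneg : ∀ i j, 0 ≤ R i j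
  stochastic : (P + Q + R) *ᵥ 1 = 1

/-- All matrix entries, as a triple of real functions. -/
def Site.entries {d : ℕ} (s : Site d) :
    (Fin d → Fin d → ℝ) × (Fin d → Fin d → ℝ) × (Fin d → Fin d → ℝ) :=
  (fun i j => s.P i j, fun i j => s.Q i j, fun i j => s.R i j)

/-- The σ-algebra generated by the matrix entries. -/
instance (d : ℕ) : MeasurableSpace (Site d) := MeasurableSpace.comap Site.entries inferInstance

/-- An environment is a bi-infinite sequence of layers; the σ-algebra is the product one. -/
abbrev Env (d : ℕ) := ℤ → Site d

/-- The shift by `m` layers, `(θ^m ω)_n = ω_{n+m}`. -/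
def shift {d : ℕ} (m : ℤ) (ω : Env d) : Env d := fun n => ω (n + m)

/-- Points of the strip: a layer and a height. -/
abbrev State (d : ℕ) := ℤ × Fin d

/-- The one-step transition probabilities in the environment `ω`. -/
def transProb {d : ℕ} (ω : Env d) (z z' : State d) : ℝ :=
  if z'.1 = z.1 + 1 then (ω z.1).P z.2 z'.2
  else if z'.1 = z.1 then (ω z.1).R z.2 z'.2
  else if z'.1 = z.1 - 1 then (ω z.1).Q z.2 z'.2
  else 0

/-- The norm `max_i ∑_j |a(i,j)|`. -/
def rowNorm {d : ℕ} (A : Matrix (Fin d) (Fin d) ℝ) : ℝ := ⨆ i, ∑ j, |A i j|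

/-- The sites of layer `0` can all be reached from one another, by paths of positive probability
in the strip (such paths may leave layer `0`). -/
def LayerZeroCommunicates {d : ℕ} (ω : Env d) : Prop :=
  ∀ i j : Fin d,
    Relation.ReflTransGen (fun z z' : State d => 0 < transProb ω z z') (0, i) (0, j)

/-- Condition C of Bolthausen and Goldsheid, for a stationary law `Pr` of the environment. -/
structure ConditionC {d : ℕ} (Pr : Measure (Env d)) : Prop where
  ergodic : Ergodic (shift 1) Pr
  right_lt_one : ∀ n : ℤ, ∀ᵐ ω ∂Pr, rowNorm ((ω n).R + (ω n).P) < 1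
  right_integrable : ∀ n : ℤ,
    Integrable (fun ω : Env d => Real.log (1 - rowNorm ((ω n).R + (ω n).P))⁻¹) Pr
  left_lt_one : ∀ n : ℤ, ∀ᵐ ω ∂Pr, rowNorm ((ω n).R + (ω n).Q) < 1
  left_integrable : ∀ n : ℤ,
    Integrable (fun ω : Env d => Real.log (1 - rowNorm ((ω n).R + (ω n).Q))⁻¹) Pr
  col_pos : ∀ n : ℤ, ∀ᵐ ω ∂Pr, ∀ j : Fin d,
    0 < ∑ i, (ω n).Q i j ∧ 0 < ∑ i, (ω n).P i j
  communicates : 0 < Pr {ω | LayerZeroCommunicates ω}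

/-! ### The walk -/

/-- The class of measurable families of probability vectors on the heights, indexed by
the environment. -/
structure InitialLaw (d : ℕ) where
  toFun : Env d → Fin d → ℝ
  measurable' : Measurable toFun
  mem_simplex : ∀ ω, toFun ω ∈ stdSimplex ℝ (Fin d)

instance (d : ℕ) : CoeFun (InitialLaw d) (fun _ => Env d → Fin d → ℝ) := ⟨InitialLaw.toFun⟩

/-- The law of the starting point `(0, Y_0)`, with `Y_0` distributed as `μ_ω`. -/
def startLaw {d : ℕ} (μ : InitialLaw d) (ω : Env d) : Measure (State d) :=
  ∑ j, ENNReal.ofReal (μ ω j) • Measure.dirac ((0 : ℤ), j)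

instance {d : ℕ} (μ : InitialLaw d) (ω : Env d) : IsProbabilityMeasure (startLaw μ ω) := by
  constructor
  have h := μ.mem_simplex ω
  simp only [startLaw, Measure.coe_finsetSum, Finset.sum_apply, Measure.smul_apply,
    measure_univ, smul_eq_mul, mul_one]
  rw [← ENNReal.ofReal_sum_of_nonneg (fun j _ => h.1 j), h.2, ENNReal.ofReal_one]

/-- The law of one step from `z`. -/
def stepLaw {d : ℕ} (ω : Env d) (z : State d) : Measure (State d) :=
  Measure.sum fun z' => ENNReal.ofReal (transProb ω z z') • Measure.dirac z'

lemma transProb_nonneg {d : ℕ} (ω : Env d) (z z' : State d) : 0 ≤ transProb ω z z' := by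
  unfold transProb
  split_ifs
  exacts [(ω z.1).P_nonneg _ _, (ω z.1).R_nonneg _ _, (ω z.1).Q_nonneg _ _, le_rfl]

lemma stepLaw_singleton {d : ℕ} (ω : Env d) (z z' : State d) :
    stepLaw ω z {z'} = ENNReal.ofReal (transProb ω z z') := by
  rw [stepLaw, Measure.sum_apply _ (measurableSet_singleton z'), tsum_eq_single z']
  · simp
  · intro b hb
    simp [hb]

instance {d : ℕ} (ω : Env d) (z : State d) : IsProbabilityMeasure (stepLaw ω z) := by
  constructor
  have hs : ∀ j, transProb ω z (z.1 + 1, j) = (ω z.1).P z.2 j := fun j => by simp [transProb]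
  have hr : ∀ j, transProb ω z (z.1, j) = (ω z.1).R z.2 j := fun j => by simp [transProb]
  have hq : ∀ j, transProb ω z (z.1 - 1, j) = (ω z.1).Q z.2 j := fun j => by
    simp [transProb, show z.1 - 1 ≠ z.1 + 1 by omega]
  rw [stepLaw, Measure.sum_apply _ MeasurableSet.univ]
  simp only [Measure.smul_apply, measure_univ, smul_eq_mul, mul_one]
  rw [ENNReal.tsum_prod', tsum_eq_sum (s := {z.1 + 1, z.1, z.1 - 1})]
  · rw [Finset.sum_insert (by simp only [Finset.mem_insert, Finset.mem_singleton]; omega), Finset.sum_insert (by simp only [Finset.mem_singleton]; omega),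
      Finset.sum_singleton]
    simp only [tsum_fintype, hs, hr, hq]
    rw [← ENNReal.ofReal_sum_of_nonneg (fun j _ => (ω z.1).P_nonneg _ _),
      ← ENNReal.ofReal_sum_of_nonneg (fun j _ => (ω z.1).R_nonneg _ _),
      ← ENNReal.ofReal_sum_of_nonneg (fun j _ => (ω z.1).Q_nonneg _ _),
      ← ENNReal.ofReal_add (Finset.sum_nonneg fun j _ => (ω z.1).R_nonneg _ _)
        (Finset.sum_nonneg fun j _ => (ω z.1).Q_nonneg _ _),
      ← ENNReal.ofReal_add (Finset.sum_nonneg fun j _ => (ω z.1).P_nonneg _ _)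
        (add_nonneg (Finset.sum_nonneg fun j _ => (ω z.1).R_nonneg _ _)
          (Finset.sum_nonneg fun j _ => (ω z.1).Q_nonneg _ _))]
    have h := congrFun (ω z.1).stochastic z.2
    simp only [Matrix.mulVec, dotProduct, Matrix.add_apply, Pi.one_apply, mul_one,
      Finset.sum_add_distrib] at h
    rw [show ∑ j, (ω z.1).P z.2 j + (∑ j, (ω z.1).R z.2 j + ∑ j, (ω z.1).Q z.2 j) = 1 by
      linarith, ENNReal.ofReal_one]
  · intro n hn
    simp only [Finset.mem_insert, Finset.mem_singleton, not_or] at hn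
    simp [transProb, hn.1, hn.2.1, hn.2.2]

/-- The transition kernel of the walk from time `n` to time `n + 1`: the next position
depends only on the current one. -/
def stepKernel {d : ℕ} (ω : Env d) (n : ℕ) :
    Kernel (Π _ : Finset.Iic n, State d) (State d) where
  toFun x := stepLaw ω (x ⟨n, Finset.mem_Iic.2 le_rfl⟩)
  measurable' := measurable_of_countable _

instance {d : ℕ} (ω : Env d) (n : ℕ) : IsMarkovKernel (stepKernel ω n) :=
  ⟨fun _ => inferInstanceAs (IsProbabilityMeasure (stepLaw ω _))⟩

/-- The quenched law of the walk: the Markov chain on the strip with transition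
probabilities `transProb ω` and starting law `startLaw μ ω`. -/
def quenchedLaw {d : ℕ} (μ : InitialLaw d) (ω : Env d) : Measure (ℕ → State d) :=
  Kernel.trajMeasure (X := fun _ => State d) (startLaw μ ω) (stepKernel ω)

instance {d : ℕ} (μ : InitialLaw d) (ω : Env d) : IsProbabilityMeasure (quenchedLaw μ ω) :=
  inferInstanceAs (IsProbabilityMeasure
    (Kernel.trajMeasure (X := fun _ => State d) (startLaw μ ω) (stepKernel ω)))

lemma quenchedLaw_zero {d : ℕ} (μ : InitialLaw d) (ω : Env d) (z : State d) :
    quenchedLaw μ ω {x | x 0 = z} = startLaw μ ω {z} := by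
  have h : (quenchedLaw μ ω).map (Preorder.frestrictLe 0) =
      (startLaw μ ω).map
        (MeasurableEquiv.piUnique (fun _ : Finset.Iic 0 => State d)).symm := by
    rw [quenchedLaw, Kernel.trajMeasure, Measure.map_comp _ _ (by fun_prop),
      Kernel.traj_map_frestrictLe, Kernel.partialTraj_self, Measure.id_comp]
  have h2 := congrArg (fun m => m {y | y ⟨0, Finset.mem_Iic.2 le_rfl⟩ = z}) h
  rw [Measure.map_apply (by fun_prop) (Set.to_countable _).measurableSet,
    Measure.map_apply (by fun_prop) (Set.to_countable _).measurableSet] at h2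
  exact h2

lemma quenchedLaw_succ {d : ℕ} (μ : InitialLaw d) (ω : Env d) (p : ℕ → State d) (n : ℕ) :
    quenchedLaw μ ω {x | ∀ k ≤ n + 1, x k = p k} =
      quenchedLaw μ ω {x | ∀ k ≤ n, x k = p k} *
        ENNReal.ofReal (transProb ω (p n) (p (n + 1))) := by
  have h := Kernel.map_frestrictLe_trajMeasure_compProd_eq_map_trajMeasure
    (X := fun _ => State d) (μ₀ := startLaw μ ω) (κ := stepKernel ω) (a := n)
  have h2 := congrArg
    (fun m => m ({Preorder.frestrictLe n p} ×ˢ {p (n + 1)})) h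
  rw [Measure.compProd_apply_prod (measurableSet_singleton _) (measurableSet_singleton _),
    lintegral_singleton, Measure.map_apply (by fun_prop) (measurableSet_singleton _),
    Measure.map_apply (by fun_prop)
      ((measurableSet_singleton _).prod (measurableSet_singleton _))] at h2
  have e1 : stepKernel ω n (Preorder.frestrictLe n p) {p (n + 1)} =
      ENNReal.ofReal (transProb ω (p n) (p (n + 1))) := stepLaw_singleton _ _ _
  have e2 : (Preorder.frestrictLe (π := fun _ => State d) n) ⁻¹' {Preorder.frestrictLe n p} =
      {x | ∀ k ≤ n, x k = p k} := by
    ext x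
    simp [funext_iff, Preorder.frestrictLe_apply]
  have e3 : (fun x : ℕ → State d => (Preorder.frestrictLe (π := fun _ => State d) n x, x (n + 1)))
      ⁻¹' ({Preorder.frestrictLe n p} ×ˢ {p (n + 1)}) = {x | ∀ k ≤ n + 1, x k = p k} := by
    ext x
    simp only [Set.mem_preimage, Set.mem_prod, Set.mem_singleton_iff, funext_iff,
      Preorder.frestrictLe_apply, Subtype.forall, Finset.mem_Iic, Set.mem_ofPred_eq]
    constructor
    · rintro ⟨h1, h2⟩ k hk
      rcases Nat.le_succ_iff.1 hk with hk | rfl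
      · exact h1 k hk
      · exact h2
    · intro h
      exact ⟨fun k hk => h k (by omega), h _ le_rfl⟩
  rw [e1, e2, e3, mul_comm] at h2
  exact h2.symm

/-- The finite-dimensional distributions of the quenched law. -/
lemma quenchedLaw_cylinder {d : ℕ} (μ : InitialLaw d) (ω : Env d) (p : ℕ → State d) (n : ℕ) :
    quenchedLaw μ ω {x | ∀ k ≤ n, x k = p k} =
      startLaw μ ω {p 0} *
        ∏ k ∈ Finset.range n, ENNReal.ofReal (transProb ω (p k) (p (k + 1))) := by
  induction n with
  | zero => simp [← quenchedLaw_zero]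
  | succ n ih => rw [quenchedLaw_succ, ih, Finset.prod_range_succ, mul_assoc]

lemma measurable_transProb {d : ℕ} (z z' : State d) :
    Measurable fun ω : Env d => transProb ω z z' := by
  have he : Measurable (Site.entries (d := d)) := comap_measurable _
  have hn : ∀ n : ℤ, Measurable fun ω : Env d => (ω n).entries :=
    fun n => he.comp (measurable_pi_apply n)
  have hP : ∀ n i j, Measurable fun ω : Env d => (ω n).P i j := fun n i j =>
    (measurable_pi_apply j).comp ((measurable_pi_apply i).comp (measurable_fst.comp (hn n)))
  have hQ : ∀ n i j, Measurable fun ω : Env d => (ω n).Q i j := fun n i j =>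
    (measurable_pi_apply j).comp ((measurable_pi_apply i).comp
      (measurable_fst.comp (measurable_snd.comp (hn n))))
  have hR : ∀ n i j, Measurable fun ω : Env d => (ω n).R i j := fun n i j =>
    (measurable_pi_apply j).comp ((measurable_pi_apply i).comp
      (measurable_snd.comp (measurable_snd.comp (hn n))))
  unfold transProb
  split_ifs
  exacts [hP _ _ _, hR _ _ _, hQ _ _ _, measurable_const]

lemma measurable_quenchedLaw_cylinder {d : ℕ} (μ : InitialLaw d) (p : ℕ → State d) (n : ℕ) :
    Measurable fun ω => quenchedLaw μ ω {x | ∀ k ≤ n, x k = p k} := by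
  simp only [quenchedLaw_cylinder]
  refine Measurable.mul ?_ (Finset.measurable_prod _ fun k _ =>
    (measurable_transProb _ _).ennreal_ofReal)
  simp only [startLaw, Measure.coe_finsetSum, Finset.sum_apply, Measure.smul_apply, smul_eq_mul]
  exact Finset.measurable_sum _ fun j _ =>
    (((measurable_pi_apply j).comp μ.measurable').ennreal_ofReal).mul_const _

lemma measurable_quenchedLaw_preimage {d : ℕ} (μ : InitialLaw d) (n : ℕ)
    (S : Set (Π _ : Finset.Iic n, State d)) :
    Measurable fun ω =>
      quenchedLaw μ ω (Preorder.frestrictLe (π := fun _ => State d) n ⁻¹' S) := by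
  let G : (Π _ : Finset.Iic n, State d) → Set (ℕ → State d) := fun y =>
    {x | Preorder.frestrictLe (π := fun _ => State d) n x = y}
  have hG : ∀ y, MeasurableSet (G y) := fun y =>
    (Preorder.measurable_frestrictLe (X := fun _ => State d) n) (measurableSet_singleton y)
  have hU : (Preorder.frestrictLe (π := fun _ => State d) n ⁻¹' S) = ⋃ y : S, G y := by
    ext x
    simp [G]
  have hd : Pairwise (Function.onFun Disjoint fun y : S => G y) := by
    intro a b hab
    refine Set.disjoint_left.2 fun x hx hx' => hab (Subtype.ext ?_)
    exact Eq.trans (Eq.symm hx) hx'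
  have hS : ∀ ω, quenchedLaw μ ω (Preorder.frestrictLe (π := fun _ => State d) n ⁻¹' S) =
      ∑' y : S, quenchedLaw μ ω (G y) := fun ω => by
    rw [hU, measure_iUnion hd fun y => hG y]
  simp only [hS]
  refine Measurable.tsum fun y => ?_
  have hp := measurable_quenchedLaw_cylinder μ
    (fun k => y.1 ⟨min k n, Finset.mem_Iic.2 (min_le_right k n)⟩) n
  have he : G y = {x | ∀ k ≤ n, x k =
      y.1 ⟨min k n, Finset.mem_Iic.2 (min_le_right k n)⟩} := by
    ext x
    simp only [G, funext_iff, Preorder.frestrictLe_apply, Subtype.forall, Finset.mem_Iic,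
      Set.mem_ofPred_eq]
    refine forall₂_congr fun k hk => ?_
    simp [min_eq_left hk]
  rw [he]
  exact hp

lemma measurable_quenchedLaw {d : ℕ} (μ : InitialLaw d) : Measurable (quenchedLaw μ) := by
  refine Measurable.measure_of_isPiSystem_of_isProbabilityMeasure
    (generateFrom_measurableCylinders (α := fun _ : ℕ => State d)).symm
    isPiSystem_measurableCylinders ?_
  intro s hs
  obtain ⟨I, S, -, rfl⟩ := (mem_measurableCylinders _).1 hs
  have hI : I ⊆ Finset.Iic (I.sup id) := fun k hk => Finset.mem_Iic.2 (Finset.le_sup (f := id) hk)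
  have he : cylinder (α := fun _ : ℕ => State d) I S =
      Preorder.frestrictLe (π := fun _ => State d) (I.sup id) ⁻¹'
        {y | (fun k : I => y ⟨k.1, hI k.2⟩) ∈ S} := rfl
  rw [he]
  exact measurable_quenchedLaw_preimage μ _ _

/-- The quenched laws as a kernel from environments to trajectories. -/
def quenchedKernel {d : ℕ} (μ : InitialLaw d) : Kernel (Env d) (ℕ → State d) :=
  ⟨quenchedLaw μ, measurable_quenchedLaw μ⟩

instance {d : ℕ} (μ : InitialLaw d) : IsMarkovKernel (quenchedKernel μ) :=
  ⟨fun ω => inferInstanceAs (IsProbabilityMeasure (quenchedLaw μ ω))⟩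

/-- The annealed law `F × G ↦ ∫_F P_ω^μ(G) Pr(dω)` of the environment and the trajectory. -/
def annealed {d : ℕ} (Pr : Measure (Env d)) (μ : InitialLaw d) :
    Measure (Env d × (ℕ → State d)) :=
  Pr ⊗ₘ quenchedKernel μ

/-- The first time at which the trajectory `x` is in layer `n` (`⊤` if there is none). -/
def hitTime {d : ℕ} (n : ℤ) (x : ℕ → State d) : ℕ∞ :=
  ⨅ (t : ℕ) (_ : (x t).1 = n), (t : ℕ∞)

/-- The annealed expectation of the hitting time of layer `1`. -/
def meanHitTime {d : ℕ} (Pr : Measure (Env d)) (μ : InitialLaw d) : ℝ≥0∞ :=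
  ∫⁻ p, ((hitTime 1 p.2 : ℕ∞) : ℝ≥0∞) ∂(annealed Pr μ)

/-- The velocity `v_p = 1 / E T_1`, which is `0` if `E T_1 = ∞`. -/
def speed {d : ℕ} (Pr : Measure (Env d)) (μ : InitialLaw d) : ℝ≥0∞ :=
  (meanHitTime Pr μ)⁻¹

/-! ### The environment viewed from the particle -/

/-- The environment viewed from the particle, with its height, at time `n`:
`(θ^{ξ_n} ω, Y_n)`. -/
def auxChain {d : ℕ} (n : ℕ) (p : Env d × (ℕ → State d)) : Env d × Fin d :=
  (shift (p.2 n).1 p.1, (p.2 n).2)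

/-- The measure `C ↦ v_p E (∑_{0 ≤ n < T_1} 1_C(θ^{ξ_n} ω, Y_n))` on environments with a
height. -/
def envMeasure {d : ℕ} (Pr : Measure (Env d)) (μ : InitialLaw d) : Measure (Env d × Fin d) :=
  speed Pr μ • Measure.sum fun n : ℕ =>
    ((annealed Pr μ).restrict {p | (n : ℕ∞) < hitTime 1 p.2}).map (auxChain n)

/-- The measure `B ↦ Q(B × {i})`. -/
def envMeasureAt {d : ℕ} (Pr : Measure (Env d)) (μ : InitialLaw d) (i : Fin d) :
    Measure (Env d) :=
  ((envMeasure Pr μ).restrict (Prod.snd ⁻¹' {i})).map Prod.fst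

/-- The measure `B ↦ Q(B × {1, …, d})`. -/
def envMeasureTotal {d : ℕ} (Pr : Measure (Env d)) (μ : InitialLaw d) : Measure (Env d) :=
  (envMeasure Pr μ).map Prod.fst

lemma measurable_shift {d : ℕ} (m : ℤ) : Measurable (shift (d := d) m) :=
  measurable_pi_lambda _ fun n => measurable_pi_apply (n + m)

lemma measurable_auxChain {d : ℕ} (n : ℕ) : Measurable (auxChain (d := d) n) := by
  have h : Measurable fun q : Env d × State d => (shift q.2.1 q.1, q.2.2) :=
    measurable_from_prod_countable_left fun z =>
      (measurable_shift z.1).prodMk (measurable_const (a := z.2))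
  exact h.comp (measurable_fst.prodMk ((measurable_pi_apply n).comp measurable_snd))

lemma measurableSet_lt_hitTime {d : ℕ} (k : ℤ) (n : ℕ) :
    MeasurableSet {p : Env d × (ℕ → State d) | (n : ℕ∞) < hitTime k p.2} := by
  have h : {p : Env d × (ℕ → State d) | (n : ℕ∞) < hitTime k p.2} =
      ⋂ t ∈ Set.Iic n, {p : Env d × (ℕ → State d) | (p.2 t).1 ≠ k} := by
    ext p
    simp only [Set.mem_ofPred_eq, Set.mem_iInter, Set.mem_Iic, hitTime]
    constructor
    · intro h t ht hk
      have h1 := h.trans_le (iInf₂_le t hk)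
      exact absurd (by exact_mod_cast h1 : n < t) (by omega)
    · intro h
      refine lt_of_lt_of_le (b := ((n + 1 : ℕ) : ℕ∞)) (by exact_mod_cast Nat.lt_succ_self n) ?_
      refine le_iInf₂ fun t ht => ?_
      have : n < t := by
        by_contra hc
        exact h t (by omega) ht
      exact_mod_cast this
  rw [h]
  refine MeasurableSet.biInter (Set.to_countable _) fun t _ => ?_
  have hm : Measurable fun p : Env d × (ℕ → State d) => (p.2 t).1 :=
    measurable_fst.comp ((measurable_pi_apply t).comp measurable_snd)
  exact hm (measurableSet_singleton k).compl

open Classical in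
/-- The defining formula of `Q` on measurable sets. -/
lemma envMeasure_apply {d : ℕ} (Pr : Measure (Env d)) (μ : InitialLaw d)
    {C : Set (Env d × Fin d)} (hC : MeasurableSet C) :
    envMeasure Pr μ C = speed Pr μ *
      ∫⁻ p, ∑' n : ℕ, (if (n : ℕ∞) < hitTime 1 p.2 ∧ auxChain n p ∈ C then 1 else 0)
        ∂(annealed Pr μ) := by
  have hm : ∀ n : ℕ, MeasurableSet
      {p : Env d × (ℕ → State d) | (n : ℕ∞) < hitTime 1 p.2 ∧ auxChain n p ∈ C} := fun n =>
    (measurableSet_lt_hitTime 1 n).inter (measurable_auxChain n hC)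
  rw [envMeasure, Measure.smul_apply, smul_eq_mul, Measure.sum_apply _ hC,
    lintegral_tsum fun n => (Measurable.ite (hm n) measurable_const measurable_const).aemeasurable]
  congr 1
  refine tsum_congr fun n => ?_
  rw [Measure.map_apply (measurable_auxChain n) hC,
    Measure.restrict_apply (measurable_auxChain n hC)]
  rw [Set.inter_comm]
  refine (lintegral_indicator_one (μ := annealed Pr μ) (hm n)).symm.trans ?_
  refine lintegral_congr fun p => ?_
  simp [Set.indicator_apply]

/-! ### The matrices in the density -/

/-- `ζ` is a sequence of stochastic matrices with `ζ_n = (I - Q_n ζ_{n-1} - R_n)⁻¹ P_n`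
for all `n`. -/
def IsZeta {d : ℕ} (ω : Env d) (ζ : ℤ → Matrix (Fin d) (Fin d) ℝ) : Prop :=
  ∀ n : ℤ, ζ n ∈ Matrix.rowStochastic ℝ (Fin d) ∧
    IsUnit (1 - (ω n).Q * ζ (n - 1) - (ω n).R) ∧
    ζ n = (1 - (ω n).Q * ζ (n - 1) - (ω n).R)⁻¹ * (ω n).P

/-- The sequence `(ζ_n)` of the environment `ω`. -/
def zeta {d : ℕ} (ω : Env d) : ℤ → Matrix (Fin d) (Fin d) ℝ :=
  Classical.epsilon (IsZeta ω)

/-- The product `ζ_{n-k} ζ_{n-k+1} ⋯ ζ_n`. -/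
def backProd {d : ℕ} (ζ : ℤ → Matrix (Fin d) (Fin d) ℝ) (n : ℤ) :
    ℕ → Matrix (Fin d) (Fin d) ℝ
  | 0 => ζ n
  | k + 1 => ζ (n - (k + 1 : ℕ)) * backProd ζ n k

/-- `y = lim_{a → -∞} u_a ζ_a ζ_{a+1} ⋯ ζ_n` for every choice of probability vectors `u_a`. -/
def IsBackwardLimit {d : ℕ} (ζ : ℤ → Matrix (Fin d) (Fin d) ℝ) (n : ℤ) (y : Fin d → ℝ) : Prop :=
  ∀ u : ℕ → Fin d → ℝ, (∀ k, u k ∈ stdSimplex ℝ (Fin d)) →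
    Tendsto (fun k => u k ᵥ* backProd ζ n k) atTop (𝓝 y)

/-- The vector `y_n` of the environment `ω`. -/
def yvec {d : ℕ} (ω : Env d) (n : ℤ) : Fin d → ℝ :=
  Classical.epsilon (IsBackwardLimit (zeta ω) n)

/-- `ũ_n = (I - Q_n ζ_{n-1} - R_n)⁻¹`. -/
def uTilde {d : ℕ} (ω : Env d) (n : ℤ) : Matrix (Fin d) (Fin d) ℝ :=
  (1 - (ω n).Q * zeta ω (n - 1) - (ω n).R)⁻¹

/-- `A_n = (I - Q_n ζ_{n-1} - R_n)⁻¹ Q_n`. -/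
def Amat {d : ℕ} (ω : Env d) (n : ℤ) : Matrix (Fin d) (Fin d) ℝ :=
  (1 - (ω n).Q * zeta ω (n - 1) - (ω n).R)⁻¹ * (ω n).Q

/-- `ζ_0 ζ_1 ⋯ ζ_{k-1}`. -/
def zetaProd {d : ℕ} (ω : Env d) : ℕ → Matrix (Fin d) (Fin d) ℝ
  | 0 => 1
  | k + 1 => zetaProd ω k * zeta ω k

/-- `A_k A_{k-1} ⋯ A_1`. -/
def AProd {d : ℕ} (ω : Env d) : ℕ → Matrix (Fin d) (Fin d) ℝ
  | 0 => 1
  | k + 1 => Amat ω (k + 1 : ℕ) * AProd ω k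

/-- The `k`-th term `ζ_0 ⋯ ζ_{k-1} A_k ⋯ A_1 ũ_0` of the matrix series. -/
def densityTerm {d : ℕ} (ω : Env d) (k : ℕ) : Matrix (Fin d) (Fin d) ℝ :=
  zetaProd ω k * AProd ω k * uTilde ω 0

/-- `Λ_ω^{(i)} = v_p [μ_ω (ũ_0 + ζ_0 A_1 ũ_0 + ζ_0 ζ_1 A_2 A_1 ũ_0 + ⋯)](i)`. -/
def densityAt {d : ℕ} (Pr : Measure (Env d)) (μ : InitialLaw d) (i : Fin d) (ω : Env d) : ℝ :=
  (speed Pr μ).toReal * (μ ω ᵥ* ∑' k, densityTerm ω k) i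

/-- `Λ_ω = v_p [μ_ω (ũ_0 + ζ_0 A_1 ũ_0 + ζ_0 ζ_1 A_2 A_1 ũ_0 + ⋯)] 𝟏`. -/
def density {d : ℕ} (Pr : Measure (Env d)) (μ : InitialLaw d) (ω : Env d) : ℝ :=
  (speed Pr μ).toReal * ((μ ω ᵥ* ∑' k, densityTerm ω k) ⬝ᵥ 1)

end StripRWRE

end

noncomputable section

namespace StripRWRE

/-! ### Nonnegative matrices -/

section Nonneg

variable {m : Type*} [Fintype m]

/-! The density is a Green function read off along the orbit of the shift. Decomposing the sum that
defines $Q_i$ according to the layer $m$ of the walk, and moving each term by the shift-invariance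
of `Pr`, gives $Q_i$ the density $v_p\sum_m G_{\theta^{-m}\omega}(m,i)$, where $G_\omega(z)$ is the
expected number of visits to $z$ before $T_1$ (`envMeasureAt_eq_withDensity`). The walk moves right
by at most one layer per step, so only $m=-k\le 0$ contributes.

The Green function is not derived from path decompositions. A candidate is written down in terms of
$\zeta$ and the resolvents, checked to solve the Poisson equation, and identified by stopping the
walk at a hitting time (`lintegral_startLaw_eq_tsum`, `greenFun_poisson`, `occupation_neg`). For the
environment $\theta^k\omega$ it yields $\mathbf y_{k-1}(\omega)A_k\cdots A_1\widetilde u_0$. Since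
$\mathbf y_{k-1}=\mathbf y_{-1}\zeta_0\cdots\zeta_{k-1}$ and $\mu_\omega=\mathbf y_{-1}$, this is
the $k$-th term of the series (`Typical.occupation_shift`). The total mass of $Q$ is at most $1$, so
the density is a.e. finite; strict positivity of $\mathbf y_{-1}$ then makes the matrix series
converge entrywise.

For $\zeta$ itself, `exitMatrix` is the minimal nonnegative solution of
$X_n=P_n+R_nX_n+Q_nX_{n-1}X_n$. Any stochastic solution dominates it, so existence and uniqueness
both follow once its row sums are $1$. Transience gives full row sums to the products
$\zeta_0\cdots\zeta_{k-1}$ at the heights charged by $\mu_\omega$. Communication of layer $0$ and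
ergodicity produce strictly positive blocks infinitely often in both directions. Blocks on the right
spread the row-sum property to every height and layer (`exitMatrix_mulVec_one_of_block`); blocks on
the left contract oscillations and give the limits $\mathbf y_n$ (`exists_isBackwardLimit`). -/

lemma mul_entry_nonneg {A B : Matrix m m ℝ} (hA : ∀ i j, 0 ≤ A i j) (hB : ∀ i j, 0 ≤ B i j) :
    ∀ i j, 0 ≤ (A * B) i j := fun i j => by
  rw [Matrix.mul_apply]
  exact Finset.sum_nonneg fun k _ => mul_nonneg (hA i k) (hB k j)

lemma mul_entry_mono {A A' B B' : Matrix m m ℝ} (hA : ∀ i j, 0 ≤ A i j)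
    (hAA : ∀ i j, A i j ≤ A' i j) (hB : ∀ i j, 0 ≤ B i j) (hBB : ∀ i j, B i j ≤ B' i j) :
    ∀ i j, (A * B) i j ≤ (A' * B') i j := fun i j => by
  simp only [Matrix.mul_apply]
  exact Finset.sum_le_sum fun k _ =>
    mul_le_mul (hAA i k) (hBB k j) (hB k j) ((hA i k).trans (hAA i k))

lemma mulVec_mono_right {A : Matrix m m ℝ} (hA : ∀ i j, 0 ≤ A i j) {v w : m → ℝ} (h : v ≤ w) :
    A *ᵥ v ≤ A *ᵥ w := fun i =>
  Finset.sum_le_sum fun j _ => mul_le_mul_of_nonneg_left (h j) (hA i j)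

lemma mulVec_entry_nonneg {A : Matrix m m ℝ} (hA : ∀ i j, 0 ≤ A i j) {v : m → ℝ} (h : 0 ≤ v) :
    0 ≤ A *ᵥ v := fun i => Finset.sum_nonneg fun j _ => mul_nonneg (hA i j) (h j)

lemma mulVec_one_apply (A : Matrix m m ℝ) (i : m) : (A *ᵥ 1) i = ∑ j, A i j := by
  simp [Matrix.mulVec, dotProduct]

lemma entry_le_one {A : Matrix m m ℝ} (hA : ∀ i j, 0 ≤ A i j) (h1 : A *ᵥ 1 ≤ 1) (i j : m) :
    A i j ≤ 1 := by
  have h := h1 i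
  rw [mulVec_one_apply] at h
  exact (Finset.single_le_sum (fun k _ => hA i k) (Finset.mem_univ j)).trans h

/-- If `A` is nonnegative with row sums less than `1`, then `1 - A` is inverse positive. -/
lemma nonneg_of_one_sub_mulVec_nonneg [DecidableEq m] {A : Matrix m m ℝ}
    (hA : ∀ i j, 0 ≤ A i j) (h1 : ∀ i, (A *ᵥ 1) i < 1) {x : m → ℝ} (hx : 0 ≤ (1 - A) *ᵥ x) :
    0 ≤ x := by
  intro k
  have : Nonempty m := ⟨k⟩
  -- Minimum principle: a negative minimum `x i` would give `(A *ᵥ x) i ≥ (A *ᵥ 1) i * x i > x i`.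
  obtain ⟨i, hi⟩ := Finite.exists_min x
  refine le_trans ?_ (hi k)
  by_contra hneg
  push Not at hneg
  have hxi : 0 ≤ x i - (A *ᵥ x) i := by
    have := hx i
    rwa [Matrix.sub_mulVec, Matrix.one_mulVec] at this
  have h2 : (A *ᵥ 1) i * x i ≤ (A *ᵥ x) i := by
    rw [mulVec_one_apply, Finset.sum_mul]
    exact Finset.sum_le_sum fun j _ => mul_le_mul_of_nonneg_left (hi j) (hA i j)
  have hneg' : x i < 0 := hneg
  nlinarith [h1 i]

lemma isUnit_one_sub [DecidableEq m] {A : Matrix m m ℝ}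
    (hA : ∀ i j, 0 ≤ A i j) (h1 : ∀ i, (A *ᵥ 1) i < 1) : IsUnit (1 - A) := by
  rw [← Matrix.mulVec_injective_iff_isUnit]
  intro x y hxy
  have h : (1 - A) *ᵥ x = (1 - A) *ᵥ y := hxy
  have a := nonneg_of_one_sub_mulVec_nonneg hA h1 (x := x - y)
    (by rw [Matrix.mulVec_sub, h, sub_self])
  have b := nonneg_of_one_sub_mulVec_nonneg hA h1 (x := y - x)
    (by rw [Matrix.mulVec_sub, h, sub_self])
  exact le_antisymm (sub_nonneg.1 b) (sub_nonneg.1 a)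

/-- Column `j` of the inverse solves `(1 - A) *ᵥ x = Pi.single j 1`, whose right side is
nonnegative. -/
lemma inv_one_sub_nonneg [DecidableEq m] {A : Matrix m m ℝ}
    (hA : ∀ i j, 0 ≤ A i j) (h1 : ∀ i, (A *ᵥ 1) i < 1) : ∀ i j, 0 ≤ (1 - A)⁻¹ i j := by
  intro i j
  have hu := (Matrix.isUnit_iff_isUnit_det _).1 (isUnit_one_sub hA h1)
  have h := nonneg_of_one_sub_mulVec_nonneg hA h1 (x := (1 - A)⁻¹ *ᵥ Pi.single j 1) (by
    rw [Matrix.mulVec_mulVec, Matrix.mul_nonsing_inv _ hu, Matrix.one_mulVec]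
    exact Pi.single_nonneg.2 zero_le_one) i
  simpa using h

end Nonneg

variable {d : ℕ}

/-! ### The minimal solution of the equation for `ζ` -/

/-- A layer in which every site has an exit to the right and every site can be entered from the
left, and which leads to every site of the layer on its left. -/
structure Site.Regular (s : Site d) : Prop where
  P_row_pos : ∀ i, 0 < ∑ j, s.P i j
  P_col_pos : ∀ j, 0 < ∑ i, s.P i j
  Q_col_pos : ∀ j, 0 < ∑ i, s.Q i j

lemma Site.stochastic' (s : Site d) : s.P *ᵥ 1 + s.Q *ᵥ 1 + s.R *ᵥ 1 = 1 := by
  rw [← Matrix.add_mulVec, ← Matrix.add_mulVec, s.stochastic]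

/-- The probabilities of entering layer `n + 1` from layer `n`, along excursions to the left
that are nested at most `k` times. -/
def exitApprox (ω : Env d) : ℕ → ℤ → Matrix (Fin d) (Fin d) ℝ
  | 0, _ => 0
  | k + 1, n => (ω n).P + (ω n).R * exitApprox ω k n +
      (ω n).Q * (exitApprox ω k (n - 1) * exitApprox ω k n)

lemma exitApprox_nonneg (ω : Env d) (k : ℕ) : ∀ n i j, 0 ≤ exitApprox ω k n i j := by
  induction k with
  | zero => intro n i j; simp [exitApprox]
  | succ k ih =>
    intro n i j
    exact add_nonneg (add_nonneg ((ω n).P_nonneg i j)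
      (mul_entry_nonneg (ω n).R_nonneg (ih n) i j))
      (mul_entry_nonneg (ω n).Q_nonneg (mul_entry_nonneg (ih (n - 1)) (ih n)) i j)

/-- The recursion is monotone on nonnegative matrices and starts at `0`, below every fixed point.
Monotonicity in `k` has the same cause. -/
lemma exitApprox_le_of_fixed {ω : Env d} {X : ℤ → Matrix (Fin d) (Fin d) ℝ}
    (hX : ∀ n i j, 0 ≤ X n i j)
    (hfix : ∀ n, X n = (ω n).P + (ω n).R * X n + (ω n).Q * (X (n - 1) * X n)) (k : ℕ) :
    ∀ n i j, exitApprox ω k n i j ≤ X n i j := by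
  induction k with
  | zero => intro n i j; simpa [exitApprox] using hX n i j
  | succ k ih =>
    intro n i j
    rw [hfix n]
    exact add_le_add (add_le_add le_rfl
      (mul_entry_mono (ω n).R_nonneg (fun _ _ => le_rfl) (exitApprox_nonneg ω k n) (ih n) i j))
      (mul_entry_mono (ω n).Q_nonneg (fun _ _ => le_rfl)
        (mul_entry_nonneg (exitApprox_nonneg ω k (n - 1)) (exitApprox_nonneg ω k n))
        (mul_entry_mono (exitApprox_nonneg ω k (n - 1)) (ih (n - 1))
          (exitApprox_nonneg ω k n) (ih n)) i j)

lemma exitApprox_le_succ (ω : Env d) (k : ℕ) :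
    ∀ n i j, exitApprox ω k n i j ≤ exitApprox ω (k + 1) n i j := by
  induction k with
  | zero => intro n i j; exact exitApprox_nonneg ω 1 n i j
  | succ k ih =>
    intro n i j
    exact add_le_add (add_le_add le_rfl
      (mul_entry_mono (ω n).R_nonneg (fun _ _ => le_rfl) (exitApprox_nonneg ω k n) (ih n) i j))
      (mul_entry_mono (ω n).Q_nonneg (fun _ _ => le_rfl)
        (mul_entry_nonneg (exitApprox_nonneg ω k (n - 1)) (exitApprox_nonneg ω k n))
        (mul_entry_mono (exitApprox_nonneg ω k (n - 1)) (ih (n - 1))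
          (exitApprox_nonneg ω k n) (ih n)) i j)

/-- The recursion preserves substochasticity, because `P + Q + R` has row sums `1`. This bound makes
the monotone limit finite. -/
lemma exitApprox_mulVec_one_le (ω : Env d) (k : ℕ) : ∀ n, exitApprox ω k n *ᵥ 1 ≤ 1 := by
  induction k with
  | zero => intro n; simp [exitApprox]
  | succ k ih =>
    intro n
    have h2 : exitApprox ω k (n - 1) *ᵥ (exitApprox ω k n *ᵥ 1) ≤ 1 :=
      (mulVec_mono_right (exitApprox_nonneg ω k (n - 1)) (ih n)).trans (ih (n - 1))
    calc exitApprox ω (k + 1) n *ᵥ 1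
        = (ω n).P *ᵥ 1 + (ω n).R *ᵥ (exitApprox ω k n *ᵥ 1) +
          (ω n).Q *ᵥ (exitApprox ω k (n - 1) *ᵥ (exitApprox ω k n *ᵥ 1)) := by
          simp only [exitApprox, Matrix.add_mulVec, Matrix.mulVec_mulVec]
      _ ≤ (ω n).P *ᵥ 1 + (ω n).R *ᵥ 1 + (ω n).Q *ᵥ 1 :=
          add_le_add (add_le_add le_rfl (mulVec_mono_right (ω n).R_nonneg (ih n)))
            (mulVec_mono_right (ω n).Q_nonneg h2)
      _ = 1 := by rw [add_right_comm, (ω n).stochastic']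

/-- The probabilities of entering layer `n + 1` from layer `n`, as the minimal nonnegative
solution of the equation for `ζ`. -/
def exitMatrix (ω : Env d) (n : ℤ) : Matrix (Fin d) (Fin d) ℝ :=
  Matrix.of fun i j => ⨆ k, exitApprox ω k n i j

lemma tendsto_exitApprox (ω : Env d) (n : ℤ) (i j : Fin d) :
    Tendsto (fun k => exitApprox ω k n i j) atTop (𝓝 (exitMatrix ω n i j)) := by
  refine tendsto_atTop_ciSup (monotone_nat_of_le_succ fun k => exitApprox_le_succ ω k n i j)
    ⟨1, ?_⟩
  rintro _ ⟨k, rfl⟩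
  exact entry_le_one (exitApprox_nonneg ω k n) (exitApprox_mulVec_one_le ω k n) i j

lemma tendsto_exitApprox_matrix (ω : Env d) (n : ℤ) :
    Tendsto (fun k => exitApprox ω k n) atTop (𝓝 (exitMatrix ω n)) :=
  tendsto_pi_nhds.2 fun i => tendsto_pi_nhds.2 fun j => tendsto_exitApprox ω n i j

lemma exitMatrix_nonneg (ω : Env d) (n : ℤ) (i j : Fin d) : 0 ≤ exitMatrix ω n i j :=
  ge_of_tendsto' (tendsto_exitApprox ω n i j) fun k => exitApprox_nonneg ω k n i j

lemma exitMatrix_mulVec_one_le (ω : Env d) (n : ℤ) : exitMatrix ω n *ᵥ 1 ≤ 1 := by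
  intro i
  rw [mulVec_one_apply]
  refine le_of_tendsto' (tendsto_finsetSum _ fun j _ => tendsto_exitApprox ω n i j) fun k => ?_
  rw [← mulVec_one_apply]
  exact exitApprox_mulVec_one_le ω k n i

lemma exitMatrix_fixed (ω : Env d) (n : ℤ) :
    exitMatrix ω n = (ω n).P + (ω n).R * exitMatrix ω n +
      (ω n).Q * (exitMatrix ω (n - 1) * exitMatrix ω n) := by
  have h1 := (tendsto_exitApprox_matrix ω n).comp (tendsto_add_atTop_nat 1)
  have h2 : Tendsto (fun k => (ω n).P + (ω n).R * exitApprox ω k n +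
      (ω n).Q * (exitApprox ω k (n - 1) * exitApprox ω k n)) atTop
      (𝓝 ((ω n).P + (ω n).R * exitMatrix ω n +
      (ω n).Q * (exitMatrix ω (n - 1) * exitMatrix ω n))) :=
    (tendsto_const_nhds.add (tendsto_const_nhds.mul (tendsto_exitApprox_matrix ω n))).add
      (tendsto_const_nhds.mul
        ((tendsto_exitApprox_matrix ω (n - 1)).mul (tendsto_exitApprox_matrix ω n)))
  exact tendsto_nhds_unique h1 h2

lemma exitMatrix_le_of_fixed {ω : Env d} {X : ℤ → Matrix (Fin d) (Fin d) ℝ}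
    (hX : ∀ n i j, 0 ≤ X n i j)
    (hfix : ∀ n, X n = (ω n).P + (ω n).R * X n + (ω n).Q * (X (n - 1) * X n))
    (n : ℤ) (i j : Fin d) : exitMatrix ω n i j ≤ X n i j :=
  le_of_tendsto' (tendsto_exitApprox ω n i j) fun k => exitApprox_le_of_fixed hX hfix k n i j

lemma P_le_exitMatrix (ω : Env d) (n : ℤ) (i j : Fin d) : (ω n).P i j ≤ exitMatrix ω n i j := by
  rw [exitMatrix_fixed]
  have h1 := mul_entry_nonneg (ω n).R_nonneg (exitMatrix_nonneg ω n) i j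
  have h2 := mul_entry_nonneg (ω n).Q_nonneg
    (mul_entry_nonneg (exitMatrix_nonneg ω (n - 1)) (exitMatrix_nonneg ω n)) i j
  simp only [Matrix.add_apply]
  linarith

lemma exitApprox_shift (m : ℤ) (ω : Env d) (k : ℕ) :
    ∀ n, exitApprox (shift m ω) k n = exitApprox ω k (n + m) := by
  induction k with
  | zero => intro n; rfl
  | succ k ih =>
    intro n
    simp only [exitApprox, ih, shift, show n - 1 + m = n + m - 1 by ring]

lemma exitMatrix_shift (m : ℤ) (ω : Env d) (n : ℤ) :
    exitMatrix (shift m ω) n = exitMatrix ω (n + m) := by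
  simp only [exitMatrix, exitApprox_shift]

/-! ### The equation for `ζ` -/

lemma killed_nonneg (s : Site d) {X : Matrix (Fin d) (Fin d) ℝ} (hX : ∀ i j, 0 ≤ X i j) :
    ∀ i j, 0 ≤ (s.Q * X + s.R) i j := fun i j =>
  add_nonneg (mul_entry_nonneg s.Q_nonneg hX i j) (s.R_nonneg i j)

/-- Each row loses at least its `P`-row sum, which is positive in a regular layer; hence `1 - Q X -
R` is invertible with nonnegative inverse for every substochastic `X`. -/
lemma killed_mulVec_one_lt {s : Site d} (hs : s.Regular) {X : Matrix (Fin d) (Fin d) ℝ}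
    (h1 : X *ᵥ 1 ≤ 1) (i : Fin d) : ((s.Q * X + s.R) *ᵥ 1) i < 1 := by
  have h2 := mulVec_mono_right s.Q_nonneg h1 i
  have h3 := congrFun s.stochastic' i
  have h4 := hs.P_row_pos i
  rw [← mulVec_one_apply] at h4
  simp only [Matrix.add_mulVec, ← Matrix.mulVec_mulVec, Pi.add_apply, Pi.one_apply] at h3 ⊢
  linarith

lemma isUnit_killed {s : Site d} (hs : s.Regular) {X : Matrix (Fin d) (Fin d) ℝ}
    (hX : ∀ i j, 0 ≤ X i j) (h1 : X *ᵥ 1 ≤ 1) : IsUnit (1 - s.Q * X - s.R) := by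
  rw [sub_sub]
  exact isUnit_one_sub (killed_nonneg s hX) (killed_mulVec_one_lt hs h1)

lemma inv_killed_nonneg {s : Site d} (hs : s.Regular) {X : Matrix (Fin d) (Fin d) ℝ}
    (hX : ∀ i j, 0 ≤ X i j) (h1 : X *ᵥ 1 ≤ 1) : ∀ i j, 0 ≤ (1 - s.Q * X - s.R)⁻¹ i j := by
  rw [sub_sub]
  exact inv_one_sub_nonneg (killed_nonneg s hX) (killed_mulVec_one_lt hs h1)

lemma IsZeta.nonneg {ω : Env d} {ζ : ℤ → Matrix (Fin d) (Fin d) ℝ} (h : IsZeta ω ζ) (n : ℤ)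
    (i j : Fin d) : 0 ≤ ζ n i j := (h n).1.1 i j

lemma IsZeta.mulVec_one {ω : Env d} {ζ : ℤ → Matrix (Fin d) (Fin d) ℝ} (h : IsZeta ω ζ) (n : ℤ) :
    ζ n *ᵥ 1 = 1 := (h n).1.2

/-- Clearing the inverse turns the defining equation into the polynomial one, so the minimality of
`exitMatrix` applies to every candidate. -/
lemma IsZeta.fixed {ω : Env d} {ζ : ℤ → Matrix (Fin d) (Fin d) ℝ} (h : IsZeta ω ζ) (n : ℤ) :
    ζ n = (ω n).P + (ω n).R * ζ n + (ω n).Q * (ζ (n - 1) * ζ n) := by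
  have hu := (Matrix.isUnit_iff_isUnit_det _).1 (h n).2.1
  have h1 : (1 - (ω n).Q * ζ (n - 1) - (ω n).R) * ζ n = (ω n).P := by
    conv_lhs => rw [(h n).2.2]
    exact Matrix.mul_nonsing_inv_cancel_left _ _ hu
  rw [← h1]
  noncomm_ring

lemma killed_mul_exitMatrix (ω : Env d) (n : ℤ) :
    (1 - (ω n).Q * exitMatrix ω (n - 1) - (ω n).R) * exitMatrix ω n = (ω n).P := by
  have h := exitMatrix_fixed ω n
  calc _ = exitMatrix ω n - (ω n).R * exitMatrix ω n -
        (ω n).Q * (exitMatrix ω (n - 1) * exitMatrix ω n) := by noncomm_ring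
    _ = (ω n).P := by conv_lhs => { enter [1, 1]; rw [h] }; abel

lemma isZeta_exitMatrix {ω : Env d} (hω : ∀ n, (ω n).Regular)
    (h1 : ∀ n, exitMatrix ω n *ᵥ 1 = 1) : IsZeta ω (exitMatrix ω) := by
  intro n
  have hu := isUnit_killed (hω n) (exitMatrix_nonneg ω (n - 1)) (exitMatrix_mulVec_one_le ω (n - 1))
  refine ⟨⟨exitMatrix_nonneg ω n, h1 n⟩, hu, ?_⟩
  rw [← killed_mul_exitMatrix ω n, Matrix.nonsing_inv_mul_cancel_left _ _ ((Matrix.isUnit_iff_isUnit_det _).1 hu)]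

/-- Minimality gives an entrywise inequality, and two matrices so ordered with equal row sums
coincide. -/
lemma IsZeta.eq_exitMatrix {ω : Env d} (h1 : ∀ n, exitMatrix ω n *ᵥ 1 = 1)
    {ζ : ℤ → Matrix (Fin d) (Fin d) ℝ} (h : IsZeta ω ζ) : ζ = exitMatrix ω := by
  funext n
  ext i j
  have hle := exitMatrix_le_of_fixed h.nonneg h.fixed n i
  have hs : ∑ j, exitMatrix ω n i j = ∑ j, ζ n i j := by
    rw [← mulVec_one_apply, ← mulVec_one_apply, h1, h.mulVec_one]
  exact ((Finset.sum_eq_sum_iff_of_le fun j _ => hle j).1 hs j (Finset.mem_univ j)).symm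

lemma zeta_eq_exitMatrix {ω : Env d} (hω : ∀ n, (ω n).Regular)
    (h1 : ∀ n, exitMatrix ω n *ᵥ 1 = 1) : zeta ω = exitMatrix ω :=
  IsZeta.eq_exitMatrix h1 (Classical.epsilon_spec ⟨_, isZeta_exitMatrix hω h1⟩)

/-- If a layer is left to the right almost surely, then so is the layer on its left. -/
lemma exitMatrix_mulVec_one_pred {ω : Env d} {n : ℤ} (hω : (ω n).Regular)
    (h1 : exitMatrix ω n *ᵥ 1 = 1) : exitMatrix ω (n - 1) *ᵥ 1 = 1 := by
  have h := congrArg (· *ᵥ 1) (exitMatrix_fixed ω n)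
  simp only [Matrix.add_mulVec, ← Matrix.mulVec_mulVec, h1] at h
  have hs := (ω n).stochastic'
  have hle := exitMatrix_mulVec_one_le ω (n - 1)
  funext j
  by_contra hne
  have hlt : (exitMatrix ω (n - 1) *ᵥ 1) j < (1 : Fin d → ℝ) j := lt_of_le_of_ne (hle j) hne
  -- The fixed-point equation applied to `1`, compared with stochasticity of the layer, forces `Q *ᵥ
  -- (1 - exitMatrix ω (n - 1) *ᵥ 1) = 0`. A deficit at `j` is excluded by a positive entry in
  -- column `j` of `Q`.
  obtain ⟨i, -, hi⟩ := Finset.exists_lt_of_sum_lt (s := Finset.univ) (f := fun _ : Fin d => (0 : ℝ))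
    (g := fun i => (ω n).Q i j) (by simpa using hω.Q_col_pos j)
  have h2 : ((ω n).Q *ᵥ (exitMatrix ω (n - 1) *ᵥ 1)) i < ((ω n).Q *ᵥ 1) i :=
    Finset.sum_lt_sum (fun k _ => mul_le_mul_of_nonneg_left (hle k) ((ω n).Q_nonneg i k))
      ⟨j, Finset.mem_univ j, mul_lt_mul_of_pos_left hlt hi⟩
  have h3 := congrFun h i
  have h4 := congrFun hs i
  simp only [Pi.add_apply] at h3 h4
  linarith

/-! ### Products over consecutive layers -/

/-- The product `ζ_m ζ_{m+1} ⋯ ζ_{m+k-1}`. -/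
def layerProd (ζ : ℤ → Matrix (Fin d) (Fin d) ℝ) : ℤ → ℕ → Matrix (Fin d) (Fin d) ℝ
  | _, 0 => 1
  | m, k + 1 => ζ m * layerProd ζ (m + 1) k

lemma layerProd_add (ζ : ℤ → Matrix (Fin d) (Fin d) ℝ) (k l : ℕ) :
    ∀ m, layerProd ζ m (k + l) = layerProd ζ m k * layerProd ζ (m + k) l := by
  induction k with
  | zero => intro m; simp [layerProd]
  | succ k ih =>
    intro m
    rw [show k + 1 + l = (k + l) + 1 by ring]
    simp only [layerProd, ih, Matrix.mul_assoc]
    rw [show m + 1 + (k : ℤ) = m + (k + 1 : ℕ) by push_cast; ring]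

lemma layerProd_succ' (ζ : ℤ → Matrix (Fin d) (Fin d) ℝ) (m : ℤ) (k : ℕ) :
    layerProd ζ m (k + 1) = layerProd ζ m k * ζ (m + k) := by
  rw [layerProd_add]
  simp [layerProd]

lemma layerProd_nonneg {ζ : ℤ → Matrix (Fin d) (Fin d) ℝ} (hζ : ∀ n i j, 0 ≤ ζ n i j) (k : ℕ) :
    ∀ m i j, 0 ≤ layerProd ζ m k i j := by
  induction k with
  | zero =>
    intro m i j
    simp only [layerProd, Matrix.one_apply]
    split_ifs <;> norm_num
  | succ k ih => intro m; exact mul_entry_nonneg (hζ m) (ih (m + 1))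

lemma layerProd_mulVec_one_le {ζ : ℤ → Matrix (Fin d) (Fin d) ℝ} (hζ : ∀ n i j, 0 ≤ ζ n i j)
    (h1 : ∀ n, ζ n *ᵥ 1 ≤ 1) (k : ℕ) : ∀ m, layerProd ζ m k *ᵥ 1 ≤ 1 := by
  induction k with
  | zero => intro m; simp [layerProd]
  | succ k ih =>
    intro m
    rw [layerProd, ← Matrix.mulVec_mulVec]
    exact (mulVec_mono_right (hζ m) (ih (m + 1))).trans (h1 m)

lemma layerProd_mulVec_one {ζ : ℤ → Matrix (Fin d) (Fin d) ℝ}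
    (h1 : ∀ n, ζ n *ᵥ 1 = 1) (k : ℕ) : ∀ m, layerProd ζ m k *ᵥ 1 = 1 := by
  induction k with
  | zero => intro m; simp [layerProd]
  | succ k ih =>
    intro m
    rw [layerProd, ← Matrix.mulVec_mulVec, ih, h1]

lemma layerProd_col_pos {ζ : ℤ → Matrix (Fin d) (Fin d) ℝ} (hζ : ∀ n i j, 0 ≤ ζ n i j)
    (hcol : ∀ n j, ∃ i, 0 < ζ n i j) (k : ℕ) : ∀ m j, ∃ i, 0 < layerProd ζ m k i j := by
  induction k with
  | zero => intro m j; exact ⟨j, by simp [layerProd]⟩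
  | succ k ih =>
    intro m j
    obtain ⟨l, hl⟩ := ih (m + 1) j
    obtain ⟨i, hi⟩ := hcol m l
    refine ⟨i, ?_⟩
    rw [layerProd, Matrix.mul_apply]
    exact Finset.sum_pos' (fun k _ => mul_nonneg (hζ m i k) (layerProd_nonneg hζ _ _ _ _))
      ⟨l, Finset.mem_univ l, mul_pos hi hl⟩

lemma exitMatrix_col_pos {ω : Env d} (hω : ∀ n, (ω n).Regular) (n : ℤ) (j : Fin d) :
    ∃ i, 0 < exitMatrix ω n i j := by
  obtain ⟨i, -, hi⟩ := Finset.exists_lt_of_sum_lt (s := Finset.univ) (f := fun _ : Fin d => (0 : ℝ))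
    (g := fun i => (ω n).P i j) (by simpa using (hω n).P_col_pos j)
  exact ⟨i, lt_of_lt_of_le hi (P_le_exitMatrix ω n i j)⟩

lemma layerProd_shift (m : ℤ) (ω : Env d) (k : ℕ) :
    ∀ n, layerProd (exitMatrix (shift m ω)) n k = layerProd (exitMatrix ω) (n + m) k := by
  induction k with
  | zero => intro n; rfl
  | succ k ih =>
    intro n
    rw [layerProd, layerProd, ih, exitMatrix_shift, show n + 1 + m = n + m + 1 by ring]

/-! ### Entrance distributions and strictly positive blocks -/

/-- The distribution of the entrance point to layer `N`, from layer `m ≤ N`. -/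
def hitMatrix (ω : Env d) (N m : ℤ) : Matrix (Fin d) (Fin d) ℝ :=
  layerProd (exitMatrix ω) m (N - m).toNat

lemma hitMatrix_of_lt (ω : Env d) {N m : ℤ} (h : m < N) :
    hitMatrix ω N m = exitMatrix ω m * hitMatrix ω N (m + 1) := by
  rw [hitMatrix, hitMatrix, show (N - m).toNat = (N - (m + 1)).toNat + 1 by omega, layerProd]

lemma hitMatrix_nonneg (ω : Env d) (N m : ℤ) : ∀ i j, 0 ≤ hitMatrix ω N m i j :=
  layerProd_nonneg (exitMatrix_nonneg ω) _ _

/-- From layer `m - 1` the walk must pass through `m`, so `hitMatrix ω N (m - 1)` factors through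
`hitMatrix ω N m` and the identity reduces to the fixed-point equation. -/
lemma hitMatrix_harmonic (ω : Env d) {N m : ℤ} (h : m < N) :
    hitMatrix ω N m = (ω m).P * hitMatrix ω N (m + 1) + (ω m).R * hitMatrix ω N m +
      (ω m).Q * hitMatrix ω N (m - 1) := by
  have h1 := hitMatrix_of_lt ω (N := N) (m := m - 1) (by omega)
  rw [sub_add_cancel] at h1
  rw [h1, hitMatrix_of_lt ω h]
  conv_lhs => rw [exitMatrix_fixed]
  noncomm_ring

lemma hitMatrix_pos_of_step {ω : Env d} {N : ℤ} {z z' : State d} (hz : z.1 < N)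
    (h : 0 < transProb ω z z') {j : Fin d} (hpos : 0 < hitMatrix ω N z'.1 z'.2 j) :
    0 < hitMatrix ω N z.1 z.2 j := by
  have hterm : ∀ (A B : Matrix (Fin d) (Fin d) ℝ), (∀ i j, 0 ≤ A i j) → (∀ i j, 0 ≤ B i j) →
      0 < A z.2 z'.2 → 0 < B z'.2 j → 0 < (A * B) z.2 j := by
    intro A B hA hB h1 h2
    rw [Matrix.mul_apply]
    exact Finset.sum_pos' (fun k _ => mul_nonneg (hA _ _) (hB _ _))
      ⟨z'.2, Finset.mem_univ _, mul_pos h1 h2⟩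
  have hP := mul_entry_nonneg (ω z.1).P_nonneg (hitMatrix_nonneg ω N (z.1 + 1)) z.2 j
  have hR := mul_entry_nonneg (ω z.1).R_nonneg (hitMatrix_nonneg ω N z.1) z.2 j
  have hQ := mul_entry_nonneg (ω z.1).Q_nonneg (hitMatrix_nonneg ω N (z.1 - 1)) z.2 j
  rw [hitMatrix_harmonic ω hz]
  simp only [Matrix.add_apply]
  unfold transProb at h
  split_ifs at h with h1 h2 h3
  · rw [h1] at hpos
    have := hterm _ _ (ω z.1).P_nonneg (hitMatrix_nonneg ω N (z.1 + 1)) h hpos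
    linarith
  · rw [h2] at hpos
    have := hterm _ _ (ω z.1).R_nonneg (hitMatrix_nonneg ω N z.1) h hpos
    linarith
  · rw [h3] at hpos
    have := hterm _ _ (ω z.1).Q_nonneg (hitMatrix_nonneg ω N (z.1 - 1)) h hpos
    linarith
  · exact absurd h (lt_irrefl _)

/-- Harmonicity carries positivity backwards along each step. It holds only left of layer `N`, so
`L` has to exceed every layer from which the finite path takes a step. -/
lemma exists_hitMatrix_pos_of_path {ω : Env d} {z w : State d}
    (h : Relation.ReflTransGen (fun z z' : State d => 0 < transProb ω z z') z w) :
    ∃ L : ℕ, ∀ N : ℤ, L ≤ N → ∀ j, 0 < hitMatrix ω N w.1 w.2 j →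
      0 < hitMatrix ω N z.1 z.2 j := by
  induction h using Relation.ReflTransGen.head_induction_on with
  | refl => exact ⟨0, fun N _ j hj => hj⟩
  | @head a c hs _ ih =>
    obtain ⟨L, hL⟩ := ih
    refine ⟨max L (a.1 + 1).toNat, fun N hN j hj => ?_⟩
    refine hitMatrix_pos_of_step (by omega) hs (hL N (by omega) j hj)

/-- If layer `0` communicates, then some product `ζ_0 ⋯ ζ_{L-1}` has positive entries. -/
lemma exists_layerProd_pos {ω : Env d} (hω : ∀ n, (ω n).Regular) (hc : LayerZeroCommunicates ω) :
    ∃ L : ℕ, ∀ i j, 0 < layerProd (exitMatrix ω) 0 L i j := by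
  choose L hL using fun i j => exists_hitMatrix_pos_of_path (hc i j)
  let M : ℕ := Finset.univ.sup fun p : Fin d × Fin d => L p.1 p.2
  refine ⟨M, fun i j => ?_⟩
  -- Some height `k` of layer `0` leads to `j` with positive probability; the path from `i` to `k`
  -- transfers this to every `i`.
  obtain ⟨k, hk⟩ := layerProd_col_pos (exitMatrix_nonneg ω) (exitMatrix_col_pos hω) M 0 j
  have hM : L i k ≤ M :=
    Finset.le_sup (f := fun p : Fin d × Fin d => L p.1 p.2) (Finset.mem_univ (i, k))
  have h := hL i k M (by exact_mod_cast hM) j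
  simpa [hitMatrix] using h (by simpa [hitMatrix] using hk)

/-! ### Contraction of products of stochastic matrices -/

section Oscillation

variable {m : Type*} [Fintype m] [Nonempty m]

/-- The oscillation of a vector. -/
def osc (v : m → ℝ) : ℝ := (⨆ i, v i) - ⨅ i, v i

lemma exists_osc_eq (v : m → ℝ) :
    ∃ i j, osc v = v i - v j ∧ ∀ k, v j ≤ v k ∧ v k ≤ v i := by
  obtain ⟨i, hi⟩ := exists_eq_ciSup_of_finite (f := v)
  obtain ⟨j, hj⟩ := exists_eq_ciInf_of_finite (f := v)
  refine ⟨i, j, by rw [osc, hi, hj], fun k => ⟨?_, ?_⟩⟩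
  · rw [hj]; exact ciInf_le (Set.finite_range v).bddBelow k
  · rw [hi]; exact le_ciSup (Set.finite_range v).bddAbove k

lemma osc_nonneg (v : m → ℝ) : 0 ≤ osc v := by
  obtain ⟨i, j, h, hk⟩ := exists_osc_eq v
  rw [h]
  linarith [(hk i).1]

lemma abs_dotProduct_sub_le_osc {u u' : m → ℝ} (hu : u ∈ stdSimplex ℝ m)
    (hu' : u' ∈ stdSimplex ℝ m) (v : m → ℝ) : |u ⬝ᵥ v - u' ⬝ᵥ v| ≤ osc v := by
  obtain ⟨i, j, h, hk⟩ := exists_osc_eq v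
  have key : ∀ w ∈ stdSimplex ℝ m, v j ≤ w ⬝ᵥ v ∧ w ⬝ᵥ v ≤ v i := by
    intro w hw
    have e : ∀ c : ℝ, ∑ k, w k * c = c := fun c => by rw [← Finset.sum_mul, hw.2, one_mul]
    constructor
    · rw [← e (v j)]
      exact Finset.sum_le_sum fun k _ => mul_le_mul_of_nonneg_left (hk k).1 (hw.1 k)
    · rw [← e (v i)]
      exact Finset.sum_le_sum fun k _ => mul_le_mul_of_nonneg_left (hk k).2 (hw.1 k)
  rw [h, abs_le]
  constructor <;> linarith [(key u hu).1, (key u hu).2, (key u' hu').1, (key u' hu').2]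

/-- Every row average stays above the minimum of `v`, and gives weight at least `ε` to the
minimizing index, so it lies at least `ε * osc v` below the maximum. -/
lemma osc_mulVec_le {A : Matrix m m ℝ} {ε : ℝ} (hε : 0 ≤ ε) (hA : ∀ i j, ε ≤ A i j)
    (h1 : A *ᵥ 1 = 1) (v : m → ℝ) : osc (A *ᵥ v) ≤ (1 - ε) * osc v := by
  obtain ⟨i, j, h, hk⟩ := exists_osc_eq v
  obtain ⟨a, b, h', -⟩ := exists_osc_eq (A *ᵥ v)
  have hsum : ∀ c, ∑ k, A c k = 1 := fun c => by
    rw [← mulVec_one_apply, h1, Pi.one_apply]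
  have hlow : v j ≤ (A *ᵥ v) b := by
    calc v j = ∑ k, A b k * v j := by rw [← Finset.sum_mul, hsum, one_mul]
      _ ≤ _ := Finset.sum_le_sum fun k _ =>
        mul_le_mul_of_nonneg_left (hk k).1 (hε.trans (hA b k))
  have hup : A a j * (v i - v j) ≤ v i - (A *ᵥ v) a := by
    calc A a j * (v i - v j) ≤ ∑ k, A a k * (v i - v k) :=
          Finset.single_le_sum (f := fun k => A a k * (v i - v k))
            (fun k _ => mul_nonneg (hε.trans (hA a k)) (sub_nonneg.2 (hk k).2)) (Finset.mem_univ j)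
      _ = v i - (A *ᵥ v) a := by
          simp only [mul_sub, Finset.sum_sub_distrib, ← Finset.sum_mul, hsum, one_mul]
          rfl
  have hij : 0 ≤ v i - v j := by linarith [(hk i).1]
  have := mul_le_mul_of_nonneg_right (hA a j) hij
  rw [h', h]
  linarith

end Oscillation

/-! ### Backward products and their limits -/

lemma backProd_eq_layerProd (ζ : ℤ → Matrix (Fin d) (Fin d) ℝ) (n : ℤ) (k : ℕ) :
    backProd ζ n k = layerProd ζ (n - k) (k + 1) := by
  induction k with
  | zero => simp [backProd, layerProd]
  | succ k ih =>
    rw [backProd, ih]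
    conv_rhs => rw [layerProd, show n - ((k + 1 : ℕ) : ℤ) + 1 = n - k by push_cast; ring]

lemma backProd_eq_mul (ζ : ℤ → Matrix (Fin d) (Fin d) ℝ) (n : ℤ) {k l : ℕ} (h : k ≤ l) :
    backProd ζ n l = layerProd ζ (n - l) (l - k) * backProd ζ n k := by
  rw [backProd_eq_layerProd, backProd_eq_layerProd, show l + 1 = (l - k) + (k + 1) by omega,
    layerProd_add]
  congr 2
  push_cast [h]
  ring

lemma backProd_succ_right (ζ : ℤ → Matrix (Fin d) (Fin d) ℝ) (n : ℤ) (k : ℕ) :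
    backProd ζ n (k + 1) = backProd ζ (n - 1) k * ζ n := by
  rw [backProd_eq_layerProd, backProd_eq_layerProd, layerProd_succ']
  congr 2 <;> push_cast <;> ring

lemma row_mem_stdSimplex {A : Matrix (Fin d) (Fin d) ℝ} (hA : ∀ i j, 0 ≤ A i j)
    (h1 : A *ᵥ 1 = 1) (i : Fin d) : A i ∈ stdSimplex ℝ (Fin d) :=
  ⟨hA i, by rw [← mulVec_one_apply, h1, Pi.one_apply]⟩

/-- Positive blocks of bounded length occur arbitrarily far to the left. -/
def HasPositiveBlocks (ζ : ℤ → Matrix (Fin d) (Fin d) ℝ) : Prop :=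
  ∃ (L : ℕ) (ε : ℝ), 0 < ε ∧ ∃ᶠ a : ℕ in atTop, ∀ i j, ε ≤ layerProd ζ (-a) L i j

lemma HasPositiveBlocks.frequently_backProd {ζ : ℤ → Matrix (Fin d) (Fin d) ℝ}
    (hb : HasPositiveBlocks ζ) : ∃ (L : ℕ) (ε : ℝ), 0 < ε ∧ ∀ n : ℤ, ∃ᶠ k : ℕ in atTop, L ≤ k ∧
      ∀ i j, ε ≤ layerProd ζ (n - k) L i j := by
  obtain ⟨L, ε, hε, h⟩ := hb
  refine ⟨L, ε, hε, fun n => ?_⟩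
  have ht : Tendsto (fun a : ℕ => (n + a).toNat) atTop atTop := by
    refine tendsto_atTop.2 fun b => ?_
    filter_upwards [eventually_ge_atTop (b + n.natAbs)] with a ha
    omega
  refine ht.frequently ((h.and_eventually
    (eventually_ge_atTop (L + n.natAbs))).mono fun a ha => ⟨by omega, ?_⟩)
  have e : n - ((n + a).toNat : ℤ) = -a := by omega
  rw [e]
  exact ha.1

/-- Multiplying on the left by a stochastic matrix cannot increase the oscillation of a column, so
the oscillations converge; each positive block reduces them by the fixed factor `1 - ε`. -/
lemma tendsto_osc_backProd [Nonempty (Fin d)] {ζ : ℤ → Matrix (Fin d) (Fin d) ℝ}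
    (hζ : ∀ n i j, 0 ≤ ζ n i j) (h1 : ∀ n, ζ n *ᵥ 1 = 1) (hb : HasPositiveBlocks ζ) (n : ℤ)
    (j : Fin d) : Tendsto (fun k => osc fun i => backProd ζ n k i j) atTop (𝓝 0) := by
  set o : ℕ → ℝ := fun k => osc fun i => backProd ζ n k i j with ho
  have hcol : ∀ k l, k ≤ l → (fun i => backProd ζ n l i j) =
      layerProd ζ (n - l) (l - k) *ᵥ fun i => backProd ζ n k i j := fun k l h => by
    rw [backProd_eq_mul ζ n h]
    rfl
  have hanti : Antitone o := fun k l h => by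
    have := osc_mulVec_le le_rfl (layerProd_nonneg hζ (l - k) (n - l))
      (layerProd_mulVec_one h1 (l - k) (n - l)) (fun i => backProd ζ n k i j)
    rw [← hcol k l h] at this
    linarith
  have hlim : Tendsto o atTop (𝓝 (⨅ k, o k)) :=
    tendsto_atTop_ciInf hanti ⟨0, by rintro _ ⟨k, rfl⟩; exact osc_nonneg _⟩
  obtain ⟨L, ε, hε, hf⟩ := hb.frequently_backProd
  have hlim2 : Tendsto (fun k => o k - (1 - ε) * o (k - L)) atTop
      (𝓝 ((⨅ k, o k) - (1 - ε) * ⨅ k, o k)) :=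
    hlim.sub ((hlim.comp (tendsto_sub_atTop_nat L)).const_mul _)
  -- The contraction is known only for infinitely many `k`, which suffices because both sides
  -- converge along all `k`.
  have hle : (⨅ k, o k) - (1 - ε) * (⨅ k, o k) ≤ 0 := by
    refine le_of_tendsto_of_frequently hlim2 ((hf n).mono fun k hk => ?_)
    have := osc_mulVec_le hε.le hk.2 (layerProd_mulVec_one h1 L (n - k))
      (fun i => backProd ζ n (k - L) i j)
    have e := hcol (k - L) k (Nat.sub_le _ _)
    rw [show k - (k - L) = L by omega] at e
    rw [← e] at this
    exact sub_nonpos.2 this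
  have hge : 0 ≤ ⨅ k, o k := le_ciInf fun k => osc_nonneg _
  have h0 : (⨅ k, o k) = 0 := by nlinarith
  rwa [h0] at hlim

/-- Rows of later products are averages of the rows of an earlier one, so they differ by at most its
column oscillation. This makes one fixed row Cauchy; the same bound compares any `u k` with that
row. -/
lemma exists_isBackwardLimit [Nonempty (Fin d)] {ζ : ℤ → Matrix (Fin d) (Fin d) ℝ}
    (hζ : ∀ n i j, 0 ≤ ζ n i j) (h1 : ∀ n, ζ n *ᵥ 1 = 1) (hb : HasPositiveBlocks ζ) (n : ℤ) :
    ∃ y, IsBackwardLimit ζ n y := by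
  obtain ⟨i₀⟩ := ‹Nonempty (Fin d)›
  have : Nonempty (Fin d) := ⟨i₀⟩
  have hosc := tendsto_osc_backProd hζ h1 hb n
  have hcauchy : ∀ j, CauchySeq fun k => backProd ζ n k i₀ j := fun j => by
    refine cauchySeq_of_le_tendsto_0 _ (fun k l N hk hl => ?_) (hosc j)
    rw [backProd_eq_mul ζ n hk, backProd_eq_mul ζ n hl]
    exact abs_dotProduct_sub_le_osc
      (row_mem_stdSimplex (layerProd_nonneg hζ _ _) (layerProd_mulVec_one h1 _ _) i₀)
      (row_mem_stdSimplex (layerProd_nonneg hζ _ _) (layerProd_mulVec_one h1 _ _) i₀) _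
  choose y hy using fun j => cauchySeq_tendsto_of_complete (hcauchy j)
  refine ⟨y, fun u hu => tendsto_pi_nhds.2 fun j => ?_⟩
  have hdiff : Tendsto (fun k => (u k ᵥ* backProd ζ n k) j - backProd ζ n k i₀ j) atTop (𝓝 0) := by
    refine squeeze_zero_norm (fun k => ?_) (hosc j)
    have h := abs_dotProduct_sub_le_osc (hu k) (single_mem_stdSimplex ℝ i₀)
      (fun i => backProd ζ n k i j)
    rw [single_one_dotProduct] at h
    exact h
  simpa using hdiff.add (hy j)

lemma IsBackwardLimit.tendsto_row {ζ : ℤ → Matrix (Fin d) (Fin d) ℝ}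
    {n : ℤ} {y : Fin d → ℝ} (h : IsBackwardLimit ζ n y) (i j : Fin d) :
    Tendsto (fun k => backProd ζ n k i j) atTop (𝓝 (y j)) := by
  have := tendsto_pi_nhds.1 (h (fun _ => Pi.single i 1) fun _ => single_mem_stdSimplex ℝ i) j
  simpa using this

lemma IsBackwardLimit.eq [Nonempty (Fin d)] {ζ : ℤ → Matrix (Fin d) (Fin d) ℝ}
    {n : ℤ} {y y' : Fin d → ℝ} (h : IsBackwardLimit ζ n y) (h' : IsBackwardLimit ζ n y') :
    y = y' := by
  funext j
  exact tendsto_nhds_unique (h.tendsto_row (Classical.arbitrary _) j) (h'.tendsto_row _ j)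

lemma IsBackwardLimit.vecMul [Nonempty (Fin d)] {ζ : ℤ → Matrix (Fin d) (Fin d) ℝ}
    {n : ℤ} {y y' : Fin d → ℝ} (h : IsBackwardLimit ζ (n - 1) y) (h' : IsBackwardLimit ζ n y') :
    y' = y ᵥ* ζ n := by
  funext j
  let i : Fin d := Classical.arbitrary _
  have h1 := (h'.tendsto_row i j).comp (tendsto_add_atTop_nat 1)
  have h2 : Tendsto (fun k => ∑ l, backProd ζ (n - 1) k i l * ζ n l j) atTop
      (𝓝 (∑ l, y l * ζ n l j)) :=
    tendsto_finsetSum _ fun l _ => (h.tendsto_row i l).mul_const _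
  refine tendsto_nhds_unique h1 (h2.congr fun k => ?_)
  simp only [Function.comp, backProd_succ_right, Matrix.mul_apply]

/-- One positive block followed by a product with a positive entry in column `j` bounds that whole
column below. Further stochastic factors on the left only average it, so the bound survives in the
limit. -/
lemma IsBackwardLimit.pos [Nonempty (Fin d)] {ζ : ℤ → Matrix (Fin d) (Fin d) ℝ}
    (hζ : ∀ n i j, 0 ≤ ζ n i j) (h1 : ∀ n, ζ n *ᵥ 1 = 1)
    (hcol : ∀ n j, ∃ i, 0 < ζ n i j) (hb : HasPositiveBlocks ζ)
    {n : ℤ} {y : Fin d → ℝ} (h : IsBackwardLimit ζ n y) (j : Fin d) : 0 < y j := by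
  obtain ⟨L, ε, hε, hf⟩ := hb.frequently_backProd
  obtain ⟨k, hkL, hk⟩ := (hf n).exists
  obtain ⟨l, hl⟩ := layerProd_col_pos hζ hcol (k - L + 1) (n - (k - L : ℕ)) j
  rw [← backProd_eq_layerProd] at hl
  have hnn : ∀ a i j, 0 ≤ backProd ζ n a i j := fun a => by
    rw [backProd_eq_layerProd]; exact layerProd_nonneg hζ _ _
  have hlow : ∀ i, ε * backProd ζ n (k - L) l j ≤ backProd ζ n k i j := fun i => by
    rw [backProd_eq_mul ζ n (Nat.sub_le k L), show k - (k - L) = L by omega, Matrix.mul_apply]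
    exact (mul_le_mul_of_nonneg_right (hk i l) hl.le).trans
      (Finset.single_le_sum (f := fun x => layerProd ζ (n - k) L i x * backProd ζ n (k - L) x j)
        (fun x _ => mul_nonneg (layerProd_nonneg hζ _ _ _ _) (hnn _ _ _)) (Finset.mem_univ l))
  refine lt_of_lt_of_le (mul_pos hε hl) (ge_of_tendsto (h.tendsto_row l j) ?_)
  filter_upwards [eventually_ge_atTop k] with k' hk'
  rw [backProd_eq_mul ζ n hk', Matrix.mul_apply]
  have hs : ∑ x, layerProd ζ (n - k') (k' - k) l x = 1 := by
    rw [← mulVec_one_apply, layerProd_mulVec_one h1, Pi.one_apply]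
  calc ε * backProd ζ n (k - L) l j
      = ∑ x, layerProd ζ (n - k') (k' - k) l x * (ε * backProd ζ n (k - L) l j) := by
        rw [← Finset.sum_mul, hs, one_mul]
    _ ≤ _ := Finset.sum_le_sum fun x _ =>
        mul_le_mul_of_nonneg_left (hlow x) (layerProd_nonneg hζ _ _ _ _)

/-! ### The Markov property of the quenched law -/

/-- The Markov property at time `n`, for functions of the whole past and the next position. Path
prefixes form a countable space, so no measurability is asked of `H`. -/
lemma lintegral_quenchedLaw_step (μ : InitialLaw d) (ω : Env d) (n : ℕ)
    (H : (Π _ : Finset.Iic n, State d) × State d → ℝ≥0∞) :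
    ∫⁻ x, H (Preorder.frestrictLe (π := fun _ => State d) n x, x (n + 1)) ∂quenchedLaw μ ω =
      ∫⁻ x, ∫⁻ z, H (Preorder.frestrictLe (π := fun _ => State d) n x, z) ∂stepLaw ω (x n)
        ∂quenchedLaw μ ω := by
  have h := Kernel.map_frestrictLe_trajMeasure_compProd_eq_map_trajMeasure
    (X := fun _ => State d) (μ₀ := startLaw μ ω) (κ := stepKernel ω) (a := n)
  have hH : Measurable H := measurable_of_countable H
  have h2 := congrArg (fun m => ∫⁻ q, H q ∂m) h
  rw [Measure.lintegral_compProd hH, lintegral_map (measurable_of_countable _) (by fun_prop),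
    lintegral_map hH (by fun_prop)] at h2
  exact h2.symm

lemma quenchedLaw_map_zero (μ : InitialLaw d) (ω : Env d) :
    (quenchedLaw μ ω).map (fun x => x 0) = startLaw μ ω := by
  refine Measure.ext_iff_singleton.2 fun z => ?_
  rw [Measure.map_apply (measurable_pi_apply 0) (measurableSet_singleton z), ← quenchedLaw_zero]
  rfl

lemma lintegral_startLaw (μ : InitialLaw d) (ω : Env d) (f : State d → ℝ≥0∞) :
    ∫⁻ z, f z ∂startLaw μ ω = ∑ j, ENNReal.ofReal (μ ω j) * f (0, j) := by
  simp [startLaw, lintegral_smul_measure, lintegral_dirac]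

lemma ae_start (μ : InitialLaw d) (ω : Env d) : ∀ᵐ x ∂quenchedLaw μ ω, (x 0).1 = 0 := by
  have h : ∀ᵐ z ∂startLaw μ ω, z.1 = 0 := by
    rw [ae_iff, ← lintegral_indicator_one (Set.to_countable _).measurableSet, lintegral_startLaw]
    simp
  rw [← quenchedLaw_map_zero] at h
  exact ae_of_ae_map (measurable_pi_apply 0).aemeasurable h

lemma lintegral_stepLaw (ω : Env d) (z : State d) (f : State d → ℝ≥0∞) :
    ∫⁻ z', f z' ∂stepLaw ω z = ∑ j, ENNReal.ofReal ((ω z.1).P z.2 j) * f (z.1 + 1, j) +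
      ∑ j, ENNReal.ofReal ((ω z.1).R z.2 j) * f (z.1, j) +
      ∑ j, ENNReal.ofReal ((ω z.1).Q z.2 j) * f (z.1 - 1, j) := by
  have hs : ∀ j, transProb ω z (z.1 + 1, j) = (ω z.1).P z.2 j := fun j => by simp [transProb]
  have hr : ∀ j, transProb ω z (z.1, j) = (ω z.1).R z.2 j := fun j => by simp [transProb]
  have hq : ∀ j, transProb ω z (z.1 - 1, j) = (ω z.1).Q z.2 j := fun j => by
    simp [transProb, show z.1 - 1 ≠ z.1 + 1 by omega]
  simp only [stepLaw, lintegral_sum_measure, lintegral_smul_measure, lintegral_dirac, smul_eq_mul]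
  rw [ENNReal.tsum_prod', tsum_eq_sum (s := {z.1 + 1, z.1, z.1 - 1})]
  · rw [Finset.sum_insert (by simp only [Finset.mem_insert, Finset.mem_singleton]; omega),
      Finset.sum_insert (by simp only [Finset.mem_singleton]; omega), Finset.sum_singleton]
    simp only [tsum_fintype, hs, hr, hq, add_assoc]
  · intro n hn
    simp only [Finset.mem_insert, Finset.mem_singleton, not_or] at hn
    simp [transProb, hn.1, hn.2.1, hn.2.2]

lemma sum_ofReal_mul (a b : Fin d → ℝ) (ha : ∀ j, 0 ≤ a j) (hb : ∀ j, 0 ≤ b j) :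
    ∑ j, ENNReal.ofReal (a j) * ENNReal.ofReal (b j) = ENNReal.ofReal (a ⬝ᵥ b) := by
  rw [dotProduct, ENNReal.ofReal_sum_of_nonneg fun j _ => mul_nonneg (ha j) (hb j)]
  exact Finset.sum_congr rfl fun j _ => (ENNReal.ofReal_mul (ha j)).symm

lemma lintegral_stepLaw_ofReal (ω : Env d) (z : State d) {g : ℤ → Fin d → ℝ}
    (hg : ∀ n j, 0 ≤ g n j) :
    ∫⁻ z', ENNReal.ofReal (g z'.1 z'.2) ∂stepLaw ω z =
      ENNReal.ofReal (((ω z.1).P *ᵥ g (z.1 + 1) + (ω z.1).R *ᵥ g z.1 +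
        (ω z.1).Q *ᵥ g (z.1 - 1)) z.2) := by
  have h : ∀ A : Matrix (Fin d) (Fin d) ℝ, (∀ i j, 0 ≤ A i j) → ∀ n, 0 ≤ (A *ᵥ g n) z.2 :=
    fun A hA n => mulVec_entry_nonneg hA (hg n) z.2
  rw [lintegral_stepLaw, sum_ofReal_mul _ _ ((ω z.1).P_nonneg z.2) (hg _),
    sum_ofReal_mul _ _ ((ω z.1).R_nonneg z.2) (hg _),
    sum_ofReal_mul _ _ ((ω z.1).Q_nonneg z.2) (hg _), Pi.add_apply, Pi.add_apply,
    ENNReal.ofReal_add (add_nonneg (h _ (ω z.1).P_nonneg _) (h _ (ω z.1).R_nonneg _))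
      (h _ (ω z.1).Q_nonneg _),
    ENNReal.ofReal_add (h _ (ω z.1).P_nonneg _) (h _ (ω z.1).R_nonneg _)]
  rfl

lemma ae_step_le (μ : InitialLaw d) (ω : Env d) :
    ∀ᵐ x ∂quenchedLaw μ ω, ∀ n, (x (n + 1)).1 ≤ (x n).1 + 1 := by
  refine ae_all_iff.2 fun n => ?_
  have h : ∫⁻ x, (if (x (n + 1)).1 ≤ (x n).1 + 1 then (0 : ℝ≥0∞) else 1) ∂quenchedLaw μ ω =
      ∫⁻ x, ∫⁻ z, (if z.1 ≤ (x n).1 + 1 then (0 : ℝ≥0∞) else 1) ∂stepLaw ω (x n)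
        ∂quenchedLaw μ ω :=
    lintegral_quenchedLaw_step μ ω n fun q =>
      if q.2.1 ≤ (q.1 ⟨n, Finset.mem_Iic.2 le_rfl⟩).1 + 1 then 0 else 1
  have h0 : ∀ x : ℕ → State d, ∫⁻ z, (if z.1 ≤ (x n).1 + 1 then (0 : ℝ≥0∞) else 1)
      ∂stepLaw ω (x n) = 0 := fun x => by
    rw [lintegral_stepLaw]
    simp [show ¬ (x n).1 + 1 + 1 < (x n).1 by omega]
  rw [lintegral_congr h0, lintegral_zero] at h
  have hm : Measurable fun x : ℕ → State d =>
      if (x (n + 1)).1 ≤ (x n).1 + 1 then (0 : ℝ≥0∞) else 1 := by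
    have h1 : Measurable fun q : State d × State d =>
        if q.1.1 ≤ q.2.1 + 1 then (0 : ℝ≥0∞) else 1 := measurable_of_countable _
    have h2 : Measurable fun x : ℕ → State d => (x (n + 1), x n) := by fun_prop
    exact h1.comp h2
  rw [lintegral_eq_zero_iff hm] at h
  filter_upwards [h] with x hx
  by_contra hc
  simp [hc] at hx

/-! ### Hitting times and optional stopping -/

lemma lt_hitTime_iff (N : ℤ) (x : ℕ → State d) (n : ℕ) :
    (n : ℕ∞) < hitTime N x ↔ ∀ t ≤ n, (x t).1 ≠ N := by
  constructor
  · intro h t ht hk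
    have h1 := h.trans_le (iInf₂_le t hk)
    exact absurd (by exact_mod_cast h1 : n < t) (by omega)
  · intro h
    refine lt_of_lt_of_le (b := ((n + 1 : ℕ) : ℕ∞)) (by exact_mod_cast Nat.lt_succ_self n) ?_
    refine le_iInf₂ fun t ht => ?_
    have : n < t := by
      by_contra hc
      exact h t (by omega) ht
    exact_mod_cast this

lemma measurableSet_lt_hitTime' (N : ℤ) (n : ℕ) :
    MeasurableSet {x : ℕ → State d | (n : ℕ∞) < hitTime N x} := by
  simp only [lt_hitTime_iff, Set.ofPred_forall]
  exact MeasurableSet.iInter fun t => MeasurableSet.iInter fun _ =>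
    (measurable_fst.comp (measurable_pi_apply t)) (measurableSet_singleton N).compl

/-- Before the walk enters a layer on the right of the starting point, it is on the left of it. -/
lemma ae_lt_of_lt_hitTime (μ : InitialLaw d) (ω : Env d) {N : ℤ} (hN : 0 < N) :
    ∀ᵐ x ∂quenchedLaw μ ω, ∀ n : ℕ, (n : ℕ∞) < hitTime N x → (x n).1 < N := by
  filter_upwards [ae_start μ ω, ae_step_le μ ω] with x h0 hs n
  rw [lt_hitTime_iff]
  induction n with
  | zero => intro _; omega
  | succ n ih =>
    intro h
    have h1 := ih fun t ht => h t (by omega)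
    have h2 := hs n
    have h3 := h (n + 1) le_rfl
    omega

/-- A walk that tends to the right without ever skipping a layer cannot pass `N` without visiting
it. -/
lemma ae_hitTime_lt_top (μ : InitialLaw d) (ω : Env d)
    (h : ∀ᵐ x ∂quenchedLaw μ ω, Tendsto (fun t => (x t).1) atTop atTop) {N : ℤ} (hN : 0 < N) :
    ∀ᵐ x ∂quenchedLaw μ ω, hitTime N x < ⊤ := by
  filter_upwards [h, ae_lt_of_lt_hitTime μ ω hN] with x hx hlt
  by_contra hc
  rw [not_lt_top_iff] at hc
  obtain ⟨n, hn⟩ := (hx.eventually_ge_atTop N).exists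
  have := hlt n (by rw [hc]; exact ENat.natCast_lt_top n)
  omega

lemma tendsto_measure_lt_hitTime (μ : InitialLaw d) (ω : Env d) {N : ℤ}
    (hT : ∀ᵐ x ∂quenchedLaw μ ω, hitTime N x < ⊤) :
    Tendsto (fun n : ℕ => quenchedLaw μ ω {x | (n : ℕ∞) < hitTime N x}) atTop (𝓝 0) := by
  have h := tendsto_measure_iInter_atTop (μ := quenchedLaw μ ω)
    (s := fun n : ℕ => {x : ℕ → State d | (n : ℕ∞) < hitTime N x})
    (fun n => (measurableSet_lt_hitTime' N n).nullMeasurableSet)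
    (fun a b hab x hx => lt_of_le_of_lt (Nat.cast_le.2 hab) (Set.mem_ofPred_eq ▸ hx))
    ⟨0, measure_ne_top _ _⟩
  have h0 : quenchedLaw μ ω (⋂ n : ℕ, {x : ℕ → State d | (n : ℕ∞) < hitTime N x}) = 0 := by
    refine measure_mono_null (fun x hx => ?_) (ae_iff.1 hT)
    rw [Set.mem_iInter] at hx
    intro hlt
    obtain ⟨n, hn⟩ := ENat.ne_top_iff_exists.1 hlt.ne
    have : (n : ℕ∞) < hitTime N x := hx n
    rw [hn] at this
    exact lt_irrefl _ this
  rwa [h0] at h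

/-- A bounded nonnegative function that vanishes from layer `N` on is the expected sum of its
defects from harmonicity along the walk, up to the hitting time of layer `N`. -/
lemma lintegral_startLaw_eq_tsum (μ : InitialLaw d) (ω : Env d) {N : ℤ} (hN : 0 < N)
    (hT : ∀ᵐ x ∂quenchedLaw μ ω, hitTime N x < ⊤) {f s : State d → ℝ≥0∞} {C : ℝ≥0∞}
    (hC : C ≠ ⊤) (hfC : ∀ z, f z ≤ C) (hf0 : ∀ z, N ≤ z.1 → f z = 0)
    (hf : ∀ z, z.1 < N → f z = s z + ∫⁻ z', f z' ∂stepLaw ω z) :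
    ∫⁻ z, f z ∂startLaw μ ω =
      ∑' n : ℕ, ∫⁻ x in {x | (n : ℕ∞) < hitTime N x}, s (x n) ∂quenchedLaw μ ω := by
  set A : ℕ → Set (ℕ → State d) := fun n => {x | (n : ℕ∞) < hitTime N x} with hA
  have hAm : ∀ n, MeasurableSet (A n) := measurableSet_lt_hitTime' N
  set I : ℕ → ℝ≥0∞ := fun n => ∫⁻ x in A n, f (x n) ∂quenchedLaw μ ω with hI
  set J : ℕ → ℝ≥0∞ := fun n => ∫⁻ x in A n, s (x n) ∂quenchedLaw μ ω with hJ
  have hfm : ∀ (F : State d → ℝ≥0∞) n, Measurable fun x : ℕ → State d => F (x n) := fun F n =>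
    (measurable_of_countable F).comp (measurable_pi_apply n)
  have hI0 : I 0 = ∫⁻ z, f z ∂startLaw μ ω := by
    rw [← quenchedLaw_map_zero, lintegral_map (measurable_of_countable f) (measurable_pi_apply 0)]
    have : A 0 =ᵐ[quenchedLaw μ ω] Set.univ := by
      refine eventuallyEq_univ.2 ?_
      filter_upwards [ae_start μ ω] with x hx
      refine (lt_hitTime_iff N x 0).2 fun t ht => ?_
      rw [Nat.le_zero.1 ht, hx]
      omega
    rw [hI]
    simp only
    rw [Measure.restrict_congr_set this, Measure.restrict_univ]
  have hstep : ∀ n, I n = J n + I (n + 1) := by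
    intro n
    let S : Set (Π _ : Finset.Iic n, State d) := {y | ∀ t, (y t).1 ≠ N}
    have hS : ∀ x : ℕ → State d,
        Preorder.frestrictLe (π := fun _ => State d) n x ∈ S ↔ x ∈ A n := fun x => by
      simp only [S, A, lt_hitTime_iff, Set.mem_ofPred_eq, Subtype.forall, Finset.mem_Iic,
        Preorder.frestrictLe_apply]
    classical
    have h := lintegral_quenchedLaw_step μ ω n fun q => if q.1 ∈ S then f q.2 else 0
    simp only [hS] at h
    -- Since `f` vanishes from layer `N` on, survival up to time `n + 1` may be replaced by survival
    -- up to time `n`, an event of the past to which the Markov property applies.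
    have h1 : I (n + 1) = ∫⁻ x, (if x ∈ A n then f (x (n + 1)) else 0) ∂quenchedLaw μ ω := by
      rw [hI]
      simp only
      rw [← lintegral_indicator (hAm (n + 1))]
      refine lintegral_congr fun x => ?_
      by_cases hx : x ∈ A (n + 1)
      · have hx' : x ∈ A n := (lt_hitTime_iff N x n).2 fun t ht =>
          (lt_hitTime_iff N x (n + 1)).1 hx t (by omega)
        simp [hx, hx']
      · rw [Set.indicator_of_notMem hx]
        split_ifs with hx'
        · refine (hf0 _ ?_).symm
          by_contra hc
          refine hx ((lt_hitTime_iff N x (n + 1)).2 fun t ht => ?_)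
          rcases Nat.le_succ_iff.1 ht with ht | rfl
          · exact (lt_hitTime_iff N x n).1 hx' t ht
          · exact fun he => hc he.ge
        · rfl
    rw [h1, h, hI, hJ]
    simp only
    rw [← lintegral_indicator (hAm n), ← lintegral_indicator (hAm n),
      ← lintegral_add_left ((hfm s n).indicator (hAm n))]
    refine lintegral_congr_ae ?_
    filter_upwards [ae_lt_of_lt_hitTime μ ω hN] with x hx
    by_cases hxA : x ∈ A n
    · simp only [Set.indicator_of_mem hxA, if_pos hxA]
      exact hf _ (hx n hxA)
    · simp [hxA]
  have hsum : ∀ n, I 0 = ∑ k ∈ Finset.range n, J k + I n := by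
    intro n
    induction n with
    | zero => simp
    | succ n ih => rw [ih, Finset.sum_range_succ, hstep n, add_assoc]
  -- The remainder after `n` steps is at most `C` times the probability of not having stopped;
  -- boundedness of `f` is needed here.
  have hI_lim : Tendsto I atTop (𝓝 0) := by
    have h := ENNReal.Tendsto.const_mul (a := C) (tendsto_measure_lt_hitTime μ ω hT) (Or.inr hC)
    rw [mul_zero] at h
    refine tendsto_of_tendsto_of_tendsto_of_le_of_le tendsto_const_nhds h (fun _ => zero_le)
      fun n => ?_
    calc I n ≤ ∫⁻ _ in A n, C ∂quenchedLaw μ ω := lintegral_mono fun x => hfC _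
      _ = _ := setLIntegral_const _ _
  have hlim := (ENNReal.tendsto_nat_tsum J).add hI_lim
  rw [add_zero] at hlim
  rw [← hI0]
  exact tendsto_nhds_unique (tendsto_const_nhds.congr hsum) hlim

lemma ofReal_dotProduct_eq_tsum (μ : InitialLaw d) (ω : Env d) {N : ℤ} (hN : 0 < N)
    (hT : ∀ᵐ x ∂quenchedLaw μ ω, hitTime N x < ⊤) {g s : ℤ → Fin d → ℝ} {C : ℝ}
    (hg : ∀ n j, 0 ≤ g n j) (hs : ∀ n j, 0 ≤ s n j) (hgC : ∀ n j, g n j ≤ C)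
    (hg0 : ∀ n, N ≤ n → g n = 0)
    (hgs : ∀ n, n < N → g n = s n + ((ω n).P *ᵥ g (n + 1) + (ω n).R *ᵥ g n +
      (ω n).Q *ᵥ g (n - 1))) :
    ENNReal.ofReal (μ ω ⬝ᵥ g 0) = ∑' n : ℕ, ∫⁻ x in {x | (n : ℕ∞) < hitTime N x},
      ENNReal.ofReal (s (x n).1 (x n).2) ∂quenchedLaw μ ω := by
  rw [← sum_ofReal_mul _ _ (μ.mem_simplex ω).1 (hg 0),
    ← lintegral_startLaw μ ω fun z => ENNReal.ofReal (g z.1 z.2)]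
  refine lintegral_startLaw_eq_tsum μ ω hN hT (s := fun z => ENNReal.ofReal (s z.1 z.2))
    (C := ENNReal.ofReal C) ENNReal.ofReal_ne_top
    (fun z => ENNReal.ofReal_le_ofReal (hgC _ _)) (fun z hz => by simp [hg0 _ hz]) fun z hz => ?_
  rw [lintegral_stepLaw_ofReal ω z hg]
  conv_lhs => rw [hgs _ hz]
  refine ENNReal.ofReal_add (hs _ _) ?_
  exact add_nonneg (add_nonneg (mulVec_entry_nonneg (ω z.1).P_nonneg (hg _) _)
    (mulVec_entry_nonneg (ω z.1).R_nonneg (hg _) _)) (mulVec_entry_nonneg (ω z.1).Q_nonneg (hg _) _)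

/-- From the starting points of a walk that is transient to the right, the walk hits every layer
on the right almost surely. -/
lemma layerProd_mulVec_one_of_transient (μ : InitialLaw d) (ω : Env d)
    (h : ∀ᵐ x ∂quenchedLaw μ ω, Tendsto (fun t => (x t).1) atTop atTop) {j : Fin d}
    (hj : 0 < μ ω j) (k : ℕ) : (layerProd (exitMatrix ω) 0 k *ᵥ 1) j = 1 := by
  rcases Nat.eq_zero_or_pos k with rfl | hk
  · simp [layerProd]
  have hN : (0 : ℤ) < k := by exact_mod_cast hk
  have hle : ∀ n, hitMatrix ω k n *ᵥ 1 ≤ 1 := fun n =>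
    layerProd_mulVec_one_le (exitMatrix_nonneg ω) (exitMatrix_mulVec_one_le ω) _ n
  -- The deficit `g` is bounded, harmonic left of layer `k` and zero from there on, since `toNat`
  -- truncates the product to the identity. With zero source, optional stopping gives `μ ω ⬝ᵥ g 0 =
  -- 0`.
  let g : ℤ → Fin d → ℝ := fun n => 1 - hitMatrix ω k n *ᵥ 1
  have hge : ∀ n, (k : ℤ) ≤ n → g n = 0 := fun n hn => by
    simp [g, hitMatrix, show ((k : ℤ) - n).toNat = 0 by omega, layerProd]
  have hg : ∀ n j, 0 ≤ g n j := fun n j => sub_nonneg.2 (hle n j)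
  have key := ofReal_dotProduct_eq_tsum μ ω hN (ae_hitTime_lt_top μ ω h hN) (g := g)
    (s := fun _ => 0) (C := 1) hg (fun _ _ => le_rfl)
    (fun n j => sub_le_self _ (mulVec_entry_nonneg (hitMatrix_nonneg ω k n) zero_le_one j)) hge
    (fun n hn => by
      have h1 := congrArg (· *ᵥ (1 : Fin d → ℝ)) (hitMatrix_harmonic ω hn)
      simp only [Matrix.add_mulVec, ← Matrix.mulVec_mulVec] at h1
      funext i
      have h2 := congrFun h1 i
      have h3 := congrFun (ω n).stochastic' i
      simp only [g, Matrix.mulVec_sub, Pi.zero_apply, Pi.add_apply, Pi.sub_apply] at h2 h3 ⊢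
      linarith)
  simp only [Pi.zero_apply, ENNReal.ofReal_zero, lintegral_zero, tsum_zero,
    ENNReal.ofReal_eq_zero] at key
  have h2 : μ ω j * g 0 j ≤ μ ω ⬝ᵥ g 0 :=
    Finset.single_le_sum (f := fun l => μ ω l * g 0 l)
      (fun l _ => mul_nonneg ((μ.mem_simplex ω).1 l) (hg 0 l)) (Finset.mem_univ j)
  have h3 : g 0 j = 0 := by
    have := hg 0 j
    by_contra hne
    have := mul_pos hj (lt_of_le_of_ne this (Ne.symm hne))
    linarith
  have h4 : 1 - (hitMatrix ω k 0 *ᵥ 1) j = 0 := h3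
  simp only [hitMatrix, sub_zero, Int.toNat_natCast] at h4
  linarith

/-! ### Recurrence in ergodic systems -/

/-- The event of infinitely many visits is invariant, hence null or conull by ergodicity, and
Poincaré recurrence from `s` rules out null. -/
lemma ae_frequently_iterate_mem {α : Type*} [MeasurableSpace α] {ν : Measure α}
    [IsFiniteMeasure ν] {f : α → α} (hf : Ergodic f ν) {s : Set α} (hs : MeasurableSet s)
    (h0 : ν s ≠ 0) : ∀ᵐ x ∂ν, ∃ᶠ n in atTop, f^[n] x ∈ s := by
  have hm : MeasurableSet {x | ∃ᶠ n in atTop, f^[n] x ∈ s} := by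
    simp only [frequently_atTop, Set.ofPred_forall, Set.ofPred_exists, Set.ofPred_and]
    exact MeasurableSet.iInter fun a => MeasurableSet.iUnion fun b =>
      (MeasurableSet.const _).inter ((hf.measurable.iterate b) hs)
  have hinv : f ⁻¹' {x | ∃ᶠ n in atTop, f^[n] x ∈ s} = {x | ∃ᶠ n in atTop, f^[n] x ∈ s} := by
    ext x
    simp only [Set.mem_preimage, Set.mem_ofPred_eq, ← Function.iterate_succ_apply]
    simp only [frequently_atTop]
    constructor
    · intro h a
      obtain ⟨b, hb, hbs⟩ := h a
      exact ⟨b + 1, by omega, hbs⟩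
    · intro h a
      obtain ⟨b, hb, hbs⟩ := h (a + 1)
      exact ⟨b - 1, by omega, by rwa [Nat.succ_eq_add_one, Nat.sub_add_cancel (by omega)]⟩
  rcases hf.toPreErgodic.ae_mem_or_ae_notMem hm hinv with h | h
  · exact h
  · refine absurd ?_ h0
    have h1 := hf.toMeasurePreserving.conservative.ae_mem_imp_frequently_image_mem
      hs.nullMeasurableSet
    rw [← compl_compl s]
    refine mem_ae_iff.1 ?_
    filter_upwards [h, h1] with x hx hx' hxs
    exact hx (hx' hxs)

lemma shift_shift (m n : ℤ) (ω : Env d) : shift m (shift n ω) = shift (m + n) ω := by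
  funext k
  simp only [shift]
  congr 1
  ring

lemma shift_zero (ω : Env d) : shift 0 ω = ω := by
  funext k
  simp [shift]

/-- The shift as an automorphism of the space of environments. -/
def shiftEquiv (d : ℕ) : Env d ≃ᵐ Env d where
  toFun := shift 1
  invFun := shift (-1)
  left_inv ω := by simp [shift_shift, shift_zero]
  right_inv ω := by simp [shift_shift, shift_zero]
  measurable_toFun := measurable_shift 1
  measurable_invFun := measurable_shift (-1)

lemma shift_one_iterate (n : ℕ) (ω : Env d) : (shift 1)^[n] ω = shift n ω := by
  induction n with
  | zero => simp [shift_zero]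
  | succ n ih =>
    rw [Function.iterate_succ_apply', ih, shift_shift]
    push_cast
    rw [add_comm]

lemma shift_neg_one_iterate (n : ℕ) (ω : Env d) : (shift (-1))^[n] ω = shift (-n) ω := by
  induction n with
  | zero => simp [shift_zero]
  | succ n ih =>
    rw [Function.iterate_succ_apply', ih, shift_shift]
    congr 1
    push_cast
    ring

lemma ergodic_shift_neg_one {Pr : Measure (Env d)} (h : Ergodic (shift 1) Pr) :
    Ergodic (shift (-1)) Pr :=
  Ergodic.symm (e := shiftEquiv d) h

lemma measurePreserving_shift {Pr : Measure (Env d)} (h : Ergodic (shift 1) Pr) (m : ℤ) :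
    MeasurePreserving (shift m) Pr Pr := by
  obtain ⟨n, rfl | rfl⟩ := m.eq_nat_or_neg
  · have := h.toMeasurePreserving.iterate n
    rwa [show (shift 1)^[n] = shift (d := d) n from funext (shift_one_iterate n)] at this
  · have := (ergodic_shift_neg_one h).toMeasurePreserving.iterate n
    rwa [show (shift (-1))^[n] = shift (d := d) (-n) from funext (shift_neg_one_iterate n)] at this

/-! ### Measurability -/

lemma measurable_entries (n : ℤ) (i j : Fin d) :
    (Measurable fun ω : Env d => (ω n).P i j) ∧ (Measurable fun ω : Env d => (ω n).Q i j) ∧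
      Measurable fun ω : Env d => (ω n).R i j := by
  have he : Measurable fun ω : Env d => (ω n).entries :=
    (comap_measurable (Site.entries (d := d))).comp (measurable_pi_apply n)
  exact ⟨(measurable_pi_apply j).comp ((measurable_pi_apply i).comp (measurable_fst.comp he)),
    (measurable_pi_apply j).comp ((measurable_pi_apply i).comp
      (measurable_fst.comp (measurable_snd.comp he))),
    (measurable_pi_apply j).comp ((measurable_pi_apply i).comp
      (measurable_snd.comp (measurable_snd.comp he)))⟩

lemma measurable_mul_entry {α : Type*} [MeasurableSpace α] {A B : α → Matrix (Fin d) (Fin d) ℝ}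
    (hA : ∀ i j, Measurable fun x => A x i j) (hB : ∀ i j, Measurable fun x => B x i j)
    (i j : Fin d) : Measurable fun x => (A x * B x) i j := by
  simp only [Matrix.mul_apply]
  exact Finset.measurable_sum _ fun k _ => (hA i k).mul (hB k j)

lemma measurable_exitApprox (k : ℕ) :
    ∀ n (i j : Fin d), Measurable fun ω : Env d => exitApprox ω k n i j := by
  induction k with
  | zero => intro n i j; exact measurable_const
  | succ k ih =>
    intro n i j
    simp only [exitApprox, Matrix.add_apply]
    exact ((measurable_entries n i j).1.add (measurable_mul_entry
      (fun i j => (measurable_entries n i j).2.2) (ih n) i j)).add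
      (measurable_mul_entry (fun i j => (measurable_entries n i j).2.1)
        (measurable_mul_entry (ih (n - 1)) (ih n)) i j)

lemma measurable_exitMatrix (n : ℤ) (i j : Fin d) :
    Measurable fun ω : Env d => exitMatrix ω n i j :=
  measurable_of_tendsto_metrizable (fun k => measurable_exitApprox k n i j)
    (tendsto_pi_nhds.2 fun ω => tendsto_exitApprox ω n i j)

lemma measurable_layerProd (k : ℕ) :
    ∀ n (i j : Fin d), Measurable fun ω : Env d => layerProd (exitMatrix ω) n k i j := by
  induction k with
  | zero => intro n i j; exact measurable_const
  | succ k ih => intro n; exact measurable_mul_entry (measurable_exitMatrix n) (ih (n + 1))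

/-! ### Typical environments -/

/-- Exits to the right exist because row sums of `R + Q` are below `1`; column positivity is part of
Condition C. -/
lemma ConditionC.ae_regular {Pr : Measure (Env d)} (hC : ConditionC Pr) :
    ∀ᵐ ω ∂Pr, ∀ n, (ω n).Regular := by
  refine ae_all_iff.2 fun n => ?_
  filter_upwards [hC.col_pos n, hC.left_lt_one n] with ω h1 h2
  refine ⟨fun i => ?_, fun j => (h1 j).2, fun j => (h1 j).1⟩
  have h3 : ∑ j, |((ω n).R + (ω n).Q) i j| < 1 :=
    lt_of_le_of_lt (le_ciSup (f := fun i => ∑ j, |((ω n).R + (ω n).Q) i j|)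
      (Set.finite_range _).bddAbove i) h2
  have h4 : ∑ j, ((ω n).R + (ω n).Q) i j < 1 :=
    lt_of_le_of_lt (Finset.sum_le_sum fun j _ => le_abs_self _) h3
  have h5 := congrFun (ω n).stochastic' i
  simp only [Pi.add_apply, mulVec_one_apply, Pi.one_apply] at h5
  simp only [Matrix.add_apply, Finset.sum_add_distrib] at h4
  linarith

/-- The environments in which the product `ζ_0 ⋯ ζ_{L-1}` has entries at least `ε`. -/
def blockSet (d L : ℕ) (ε : ℝ) : Set (Env d) :=
  {ω | ∀ i j, ε ≤ layerProd (exitMatrix ω) 0 L i j}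

lemma measurableSet_blockSet (L : ℕ) (ε : ℝ) : MeasurableSet (blockSet d L ε) := by
  simp only [blockSet, Set.ofPred_forall]
  exact MeasurableSet.iInter fun i => MeasurableSet.iInter fun j =>
    measurableSet_le measurable_const (measurable_layerProd L 0 i j)

lemma shift_mem_blockSet {m : ℤ} {ω : Env d} {L : ℕ} {ε : ℝ} :
    shift m ω ∈ blockSet d L ε ↔ ∀ i j, ε ≤ layerProd (exitMatrix ω) m L i j := by
  simp only [blockSet, Set.mem_ofPred_eq, layerProd_shift, zero_add]

/-- Almost every communicating environment lies in some block set with `ε = 1 / (p + 1)`. There are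
countably many of these, so they cannot all be null. -/
lemma ConditionC.exists_blockSet {Pr : Measure (Env d)} (hC : ConditionC Pr) :
    ∃ (L : ℕ) (ε : ℝ), 0 < ε ∧ Pr (blockSet d L ε) ≠ 0 := by
  by_contra! hcon
  have hnull : Pr (⋃ q : ℕ × ℕ, blockSet d q.1 (1 / ((q.2 : ℝ) + 1))) = 0 :=
    measure_iUnion_null fun q => hcon q.1 _ (by positivity)
  refine hC.communicates.ne' (measure_mono_null_ae ?_ hnull)
  filter_upwards [hC.ae_regular] with ω hω hc
  obtain ⟨L, hL⟩ := exists_layerProd_pos hω hc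
  obtain ⟨c, hc0, hc⟩ : ∃ c : ℝ, 0 < c ∧ ∀ i j, c ≤ layerProd (exitMatrix ω) 0 L i j := by
    rcases isEmpty_or_nonempty (Fin d × Fin d) with he | hne
    · exact ⟨1, one_pos, fun i j => (he.false (i, j)).elim⟩
    · obtain ⟨p, hp⟩ := Finite.exists_min
        fun p : Fin d × Fin d => layerProd (exitMatrix ω) 0 L p.1 p.2
      exact ⟨_, hL p.1 p.2, fun i j => hp (i, j)⟩
  obtain ⟨p, hp⟩ := exists_nat_one_div_lt hc0
  exact Set.mem_iUnion.2 ⟨(L, p), fun i j => hp.le.trans (hc i j)⟩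

lemma ConditionC.ae_hasPositiveBlocks {Pr : Measure (Env d)} [IsFiniteMeasure Pr]
    (hC : ConditionC Pr) : ∀ᵐ ω ∂Pr, HasPositiveBlocks (exitMatrix ω) := by
  obtain ⟨L, ε, hε, h⟩ := hC.exists_blockSet
  filter_upwards [ae_frequently_iterate_mem (ergodic_shift_neg_one hC.ergodic)
    (measurableSet_blockSet L ε) h] with ω hω
  refine ⟨L, ε, hε, hω.mono fun a ha => ?_⟩
  rw [shift_neg_one_iterate] at ha
  exact shift_mem_blockSet.1 ha

lemma eq_one_of_mulVec_eq {A : Matrix (Fin d) (Fin d) ℝ} {v : Fin d → ℝ} {j : Fin d}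
    (hA : ∀ l, 0 < A j l) (hv : v ≤ 1) (h1 : (A *ᵥ 1) j = 1) (h : (A *ᵥ v) j = 1) : v = 1 := by
  have hs : ∑ l, A j l * v l = ∑ l, A j l * (1 : Fin d → ℝ) l := h.trans h1.symm
  have := (Finset.sum_eq_sum_iff_of_le fun l _ =>
    mul_le_mul_of_nonneg_left (hv l) (hA l).le).1 hs
  funext l
  exact mul_left_cancel₀ (hA l).ne' (this l (Finset.mem_univ l))

/-- Choose a height `j` charged by `μ ω`. Row `j` of the product up to layer `a + L` is strictly
positive, by the block, and keeps row sum `1` when one more factor is added, so that factor has all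
row sums `1`. The property then descends to all layers on the left. -/
lemma exitMatrix_mulVec_one_of_block {μ : InitialLaw d} {ω : Env d} (hω : ∀ n, (ω n).Regular)
    (h : ∀ᵐ x ∂quenchedLaw μ ω, Tendsto (fun t => (x t).1) atTop atTop) {L a : ℕ} {ε : ℝ}
    (hε : 0 < ε) (hb : ∀ i j, ε ≤ layerProd (exitMatrix ω) a L i j) (n : ℤ)
    (hn : n ≤ (a + L : ℕ)) : exitMatrix ω n *ᵥ 1 = 1 := by
  obtain ⟨j, hj⟩ : ∃ j, 0 < μ ω j := by
    by_contra! hcon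
    have h1 := (μ.mem_simplex ω).2
    have h2 : ∑ j, μ ω j ≤ 0 := Finset.sum_nonpos fun j _ => hcon j
    linarith
  have hT := layerProd_mulVec_one_of_transient μ ω h hj
  have hnn := layerProd_nonneg (exitMatrix_nonneg ω)
  obtain ⟨l₀, -, hl₀⟩ := Finset.exists_lt_of_sum_lt (s := Finset.univ)
    (f := fun _ : Fin d => (0 : ℝ)) (g := fun l => layerProd (exitMatrix ω) 0 a j l) (by
      have := hT a
      rw [mulVec_one_apply] at this
      simp [this])
  have hpos : ∀ l, 0 < layerProd (exitMatrix ω) 0 (a + L) j l := fun l => by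
    rw [layerProd_add, zero_add, Matrix.mul_apply]
    exact Finset.sum_pos' (fun k _ => mul_nonneg (hnn _ _ _ _) (hnn _ _ _ _))
      ⟨l₀, Finset.mem_univ _, mul_pos hl₀ (hε.trans_le (hb _ _))⟩
  have htop : exitMatrix ω (a + L : ℕ) *ᵥ 1 = 1 := by
    refine eq_one_of_mulVec_eq hpos (exitMatrix_mulVec_one_le ω _) (hT _) ?_
    have := hT (a + L + 1)
    rwa [layerProd_succ', zero_add, ← Matrix.mulVec_mulVec] at this
  induction n, hn using Int.leInductionDown with
  | base => exact htop
  | pred n _ ih => exact exitMatrix_mulVec_one_pred (hω n) ih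

lemma ae_quenched_transient {Pr : Measure (Env d)} [SFinite Pr] {μ : InitialLaw d}
    (htrans : ∀ᵐ p ∂annealed Pr μ, Tendsto (fun t => (p.2 t).1) atTop atTop) :
    ∀ᵐ ω ∂Pr, ∀ᵐ x ∂quenchedLaw μ ω, Tendsto (fun t => (x t).1) atTop atTop :=
  Measure.ae_ae_of_ae_compProd (μ := Pr) (κ := quenchedKernel μ)
    (p := fun p => Tendsto (fun t => (p.2 t).1) atTop atTop) htrans

lemma ConditionC.ae_exitMatrix_mulVec_one {Pr : Measure (Env d)} [IsFiniteMeasure Pr]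
    (hC : ConditionC Pr) {μ : InitialLaw d}
    (htrans : ∀ᵐ p ∂annealed Pr μ, Tendsto (fun t => (p.2 t).1) atTop atTop) :
    ∀ᵐ ω ∂Pr, ∀ n, exitMatrix ω n *ᵥ 1 = 1 := by
  obtain ⟨L, ε, hε, h⟩ := hC.exists_blockSet
  filter_upwards [ae_frequently_iterate_mem hC.ergodic (measurableSet_blockSet L ε) h,
    hC.ae_regular, ae_quenched_transient htrans] with ω hf hω ht n
  obtain ⟨a, ha, han⟩ := (hf.and_eventually (eventually_ge_atTop n.toNat)).exists
  rw [shift_one_iterate] at ha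
  exact exitMatrix_mulVec_one_of_block hω ht hε (shift_mem_blockSet.1 ha) n (by omega)

/-! ### The Green function of the walk killed on entering a layer -/

/-- The expected numbers of visits to sites of layer `n` before layer `n + 1` is entered, for the
walk started in layer `n`. -/
def resolvent (ω : Env d) (n : ℤ) : Matrix (Fin d) (Fin d) ℝ :=
  (1 - (ω n).Q * exitMatrix ω (n - 1) - (ω n).R)⁻¹

lemma resolvent_shift (m : ℤ) (ω : Env d) (n : ℤ) :
    resolvent (shift m ω) n = resolvent ω (n + m) := by
  simp only [resolvent, exitMatrix_shift, shift, show n - 1 + m = n + m - 1 by ring]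

lemma resolvent_nonneg {ω : Env d} {n : ℤ} (hω : (ω n).Regular) :
    ∀ i j, 0 ≤ resolvent ω n i j :=
  inv_killed_nonneg hω (exitMatrix_nonneg ω (n - 1)) (exitMatrix_mulVec_one_le ω (n - 1))

lemma killed_mul_resolvent {ω : Env d} {n : ℤ} (hω : (ω n).Regular) :
    (1 - (ω n).Q * exitMatrix ω (n - 1) - (ω n).R) * resolvent ω n = 1 :=
  Matrix.mul_nonsing_inv _ ((Matrix.isUnit_iff_isUnit_det _).1
    (isUnit_killed hω (exitMatrix_nonneg ω (n - 1)) (exitMatrix_mulVec_one_le ω (n - 1))))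

/-- The expected numbers of visits to sites of layer `n` before layer `n + l + 1` is entered, for
the walk started in layer `n + l`. -/
def excursionMatrix (ω : Env d) (n : ℤ) : ℕ → Matrix (Fin d) (Fin d) ℝ
  | 0 => resolvent ω n
  | l + 1 => resolvent ω (n + (l + 1 : ℕ)) * (ω (n + (l + 1 : ℕ))).Q * excursionMatrix ω n l

lemma excursionMatrix_shift (m : ℤ) (ω : Env d) (n : ℤ) (l : ℕ) :
    excursionMatrix (shift m ω) n l = excursionMatrix ω (n + m) l := by
  induction l with
  | zero => exact resolvent_shift m ω n
  | succ l ih =>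
    simp only [excursionMatrix, ih, resolvent_shift, shift]
    rw [show n + ((l + 1 : ℕ) : ℤ) + m = n + m + (l + 1 : ℕ) by ring]

lemma excursionMatrix_nonneg {ω : Env d} (hω : ∀ n, (ω n).Regular) (n : ℤ) (l : ℕ) :
    ∀ i j, 0 ≤ excursionMatrix ω n l i j := by
  induction l with
  | zero => exact resolvent_nonneg (hω n)
  | succ l ih => exact mul_entry_nonneg (mul_entry_nonneg (resolvent_nonneg (hω _)) (ω _).Q_nonneg) ih

/-- The expected number of visits to `(-k, i)` before layer `n + 1` is entered, for the walk started
in layer `n`. -/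
def excursionVec (ω : Env d) (k : ℕ) (i : Fin d) (n : ℤ) : Fin d → ℝ :=
  if n < -k then 0 else excursionMatrix ω (-k) (n + k).toNat *ᵥ Pi.single i 1

/-- The indicator function of the site `(-k, i)`. -/
def siteIndicator (k : ℕ) (i : Fin d) (n : ℤ) : Fin d → ℝ :=
  if n = -k then Pi.single i 1 else 0

/-- Before moving on to layer `n + 1`, each visit to layer `n` contributes itself when `n = -k`,
plus a possible excursion from layer `n - 1`. Extending `excursionVec` by zero left of `-k` makes
one formula cover all layers. -/
lemma excursionVec_eq (ω : Env d) (k : ℕ) (i : Fin d) (n : ℤ) :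
    excursionVec ω k i n =
      resolvent ω n *ᵥ (siteIndicator k i n + (ω n).Q *ᵥ excursionVec ω k i (n - 1)) := by
  unfold excursionVec siteIndicator
  rcases lt_trichotomy n (-k) with h | rfl | h
  · rw [if_pos h, if_neg h.ne, if_pos (by omega)]
    simp
  · simp [excursionMatrix]
  · rw [if_neg (by omega), if_neg h.ne', if_neg (by omega), zero_add, Matrix.mulVec_mulVec,
      Matrix.mulVec_mulVec]
    obtain ⟨l, hl⟩ : ∃ l : ℕ, n = -k + (l + 1 : ℕ) := ⟨(n + k - 1).toNat, by omega⟩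
    have e1 : (n + k).toNat = l + 1 := by omega
    have e2 : (n - 1 + k).toNat = l := by omega
    rw [e1, e2, excursionMatrix, ← hl, Matrix.mul_assoc]

lemma excursionVec_nonneg {ω : Env d} (hω : ∀ n, (ω n).Regular) (k : ℕ) (i : Fin d) (n : ℤ) :
    0 ≤ excursionVec ω k i n := by
  unfold excursionVec
  split_ifs
  · exact le_rfl
  · exact mulVec_entry_nonneg (excursionMatrix_nonneg hω _ _) (Pi.single_nonneg.2 zero_le_one)

/-- The expected number of visits to `(-k, i)` before layer `1` is entered, for the walk started
in layer `-l`. -/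
def greenVec (ω : Env d) (k : ℕ) (i : Fin d) : ℕ → Fin d → ℝ
  | 0 => excursionVec ω k i 0
  | l + 1 => excursionVec ω k i (-(l + 1 : ℕ)) + exitMatrix ω (-(l + 1 : ℕ)) *ᵥ greenVec ω k i l

lemma greenVec_nonneg {ω : Env d} (hω : ∀ n, (ω n).Regular) (k : ℕ) (i : Fin d) (l : ℕ) :
    0 ≤ greenVec ω k i l := by
  induction l with
  | zero => exact excursionVec_nonneg hω k i 0
  | succ l ih =>
    exact add_nonneg (excursionVec_nonneg hω k i _) (mulVec_entry_nonneg (exitMatrix_nonneg ω _) ih)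

/-- Left of the target no visit precedes the next entrance, so `greenVec` there is a substochastic
average of its values one layer to the right. The first `k + 1` layers thus bound it everywhere. -/
lemma exists_greenVec_le {ω : Env d} (hω : ∀ n, (ω n).Regular) (k : ℕ) (i : Fin d) :
    ∃ C : ℝ, 0 ≤ C ∧ ∀ l j, greenVec ω k i l j ≤ C := by
  have hnn : ∀ l j, 0 ≤ greenVec ω k i l j := fun l => greenVec_nonneg hω k i l
  refine ⟨∑ l ∈ Finset.range (k + 1), ∑ j, greenVec ω k i l j,
    Finset.sum_nonneg fun l _ => Finset.sum_nonneg fun j _ => hnn l j, fun l => ?_⟩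
  set C := ∑ l ∈ Finset.range (k + 1), ∑ j, greenVec ω k i l j with hC
  have hsmall : ∀ l ≤ k, ∀ j, greenVec ω k i l j ≤ C := fun l hl j =>
    (Finset.single_le_sum (fun j _ => hnn l j) (Finset.mem_univ j)).trans
      (Finset.single_le_sum (f := fun l => ∑ j, greenVec ω k i l j)
        (fun l _ => Finset.sum_nonneg fun j _ => hnn l j) (Finset.mem_range.2 (by omega)))
  have hC0 : 0 ≤ C := Finset.sum_nonneg fun l _ => Finset.sum_nonneg fun j _ => hnn l j
  induction l with
  | zero => exact hsmall 0 (Nat.zero_le k)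
  | succ l ih =>
    rcases le_or_gt (l + 1) k with h | h
    · exact hsmall _ h
    intro j
    rw [greenVec, excursionVec, if_pos (by omega), zero_add]
    have h1 : greenVec ω k i l ≤ C • (1 : Fin d → ℝ) := fun j => by simpa using ih j
    have h2 := mulVec_mono_right (exitMatrix_nonneg ω (-(l + 1 : ℕ))) h1 j
    rw [Matrix.mulVec_smul] at h2
    have h3 := mul_le_mul_of_nonneg_left (exitMatrix_mulVec_one_le ω (-(l + 1 : ℕ)) j) hC0
    simp only [Pi.smul_apply, smul_eq_mul, Pi.one_apply, mul_one] at h2 h3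
    exact h2.trans h3

/-- The Green function of the walk killed on entering layer `1`, with target `(-k, i)`. -/
def greenFun (ω : Env d) (k : ℕ) (i : Fin d) (n : ℤ) : Fin d → ℝ :=
  if 0 < n then 0 else greenVec ω k i (-n).toNat

lemma greenFun_eq (ω : Env d) (k : ℕ) (i : Fin d) {n : ℤ} (hn : n < 1) :
    greenFun ω k i n = excursionVec ω k i n + exitMatrix ω n *ᵥ greenFun ω k i (n + 1) := by
  rcases lt_or_eq_of_le (Int.lt_add_one_iff.1 hn : n ≤ 0) with h | rfl
  · obtain ⟨l, rfl⟩ : ∃ l : ℕ, n = -(l + 1 : ℕ) := ⟨(-n - 1).toNat, by omega⟩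
    rw [greenFun, greenFun, if_neg (by omega), if_neg (by omega),
      show (-(-((l + 1 : ℕ) : ℤ))).toNat = l + 1 by omega,
      show (-(-((l + 1 : ℕ) : ℤ) + 1)).toNat = l by omega, greenVec]
  · simp [greenFun, greenVec]

lemma greenFun_poisson {ω : Env d} (hω : ∀ n, (ω n).Regular) (k : ℕ) (i : Fin d) {n : ℤ}
    (hn : n < 1) :
    greenFun ω k i n = siteIndicator k i n + ((ω n).P *ᵥ greenFun ω k i (n + 1) +
      (ω n).R *ᵥ greenFun ω k i n + (ω n).Q *ᵥ greenFun ω k i (n - 1)) := by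
  -- Multiplying by the killed matrix cancels the resolvent and turns `exitMatrix` into `P`; the
  -- remaining `Q` terms reassemble into the value at layer `n - 1`.
  have h1 : (1 - (ω n).Q * exitMatrix ω (n - 1) - (ω n).R) *ᵥ greenFun ω k i n =
      siteIndicator k i n + (ω n).Q *ᵥ excursionVec ω k i (n - 1) +
        (ω n).P *ᵥ greenFun ω k i (n + 1) := by
    rw [greenFun_eq ω k i hn, excursionVec_eq, Matrix.mulVec_add, Matrix.mulVec_mulVec,
      killed_mul_resolvent (hω n), Matrix.one_mulVec, Matrix.mulVec_mulVec, killed_mul_exitMatrix]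
  have h2 := greenFun_eq ω k i (n := n - 1) (by omega)
  rw [sub_add_cancel] at h2
  rw [h2, Matrix.mulVec_add, Matrix.mulVec_mulVec]
  simp only [Matrix.sub_mulVec, Matrix.one_mulVec] at h1
  funext j
  have h3 := congrFun h1 j
  simp only [Pi.add_apply, Pi.sub_apply] at h3 ⊢
  linarith

/-! ### Expected occupation before entering layer 1 -/

/-- The probability of being at `z` at time `n`, before entering layer `1`. -/
def killedProb (μ : InitialLaw d) (ω : Env d) (n : ℕ) (z : State d) : ℝ≥0∞ :=
  quenchedLaw μ ω {x | (n : ℕ∞) < hitTime 1 x ∧ x n = z}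

/-- The expected number of visits to `z` before entering layer `1`. -/
def occupation (μ : InitialLaw d) (ω : Env d) (z : State d) : ℝ≥0∞ :=
  ∑' n, killedProb μ ω n z

lemma measurableSet_eq_at (n : ℕ) (z : State d) :
    MeasurableSet {x : ℕ → State d | x n = z} :=
  measurableSet_eq_fun (measurable_pi_apply n) measurable_const

lemma measurableSet_killed (n : ℕ) (z : State d) :
    MeasurableSet {x : ℕ → State d | (n : ℕ∞) < hitTime 1 x ∧ x n = z} :=
  (measurableSet_lt_hitTime' 1 n).inter (measurableSet_eq_at n z)

lemma measurable_killedProb (μ : InitialLaw d) (n : ℕ) (z : State d) :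
    Measurable fun ω => killedProb μ ω n z :=
  (Measure.measurable_coe (measurableSet_killed n z)).comp (measurable_quenchedLaw μ)

lemma measurable_occupation (μ : InitialLaw d) (z : State d) :
    Measurable fun ω => occupation μ ω z :=
  Measurable.tsum fun n => measurable_killedProb μ n z

lemma occupation_of_pos (μ : InitialLaw d) (ω : Env d) {z : State d} (hz : 0 < z.1) :
    occupation μ ω z = 0 := by
  refine ENNReal.tsum_eq_zero.2 fun n => ?_
  refine measure_mono_null (fun x hx => ?_)
    (ae_iff.1 (ae_lt_of_lt_hitTime μ ω (N := 1) one_pos))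
  intro h
  have := h n hx.1
  rw [hx.2] at this
  omega

/-- Optional stopping applied to `greenFun`, whose defect from harmonicity is the indicator of the
target; its value at layer `0` is a column of `excursionMatrix`. -/
lemma occupation_neg (μ : InitialLaw d) {ω : Env d} (hω : ∀ n, (ω n).Regular)
    (ht : ∀ᵐ x ∂quenchedLaw μ ω, Tendsto (fun t => (x t).1) atTop atTop) (k : ℕ) (i : Fin d) :
    occupation μ ω (-k, i) = ENNReal.ofReal ((μ ω ᵥ* excursionMatrix ω (-k) k) i) := by
  obtain ⟨C, hC0, hC⟩ := exists_greenVec_le hω k i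
  have key := ofReal_dotProduct_eq_tsum μ ω one_pos (ae_hitTime_lt_top μ ω ht one_pos)
    (g := greenFun ω k i) (s := siteIndicator k i) (C := C)
    (fun n j => by
      unfold greenFun
      split_ifs
      · exact le_rfl
      · exact greenVec_nonneg hω k i _ j)
    (fun n j => by
      unfold siteIndicator
      split_ifs
      · exact (Pi.single_nonneg (α := fun _ => ℝ)).2 zero_le_one j
      · exact le_rfl)
    (fun n j => by
      unfold greenFun
      split_ifs
      · exact hC0
      · exact hC _ j)
    (fun n hn => if_pos (by omega)) (fun n hn => greenFun_poisson hω k i hn)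
  have h0 : greenFun ω k i 0 = excursionMatrix ω (-k) k *ᵥ Pi.single i 1 := by
    simp [greenFun, greenVec, excursionVec]
  rw [h0, Matrix.dotProduct_mulVec, dotProduct_single_one] at key
  rw [key]
  refine tsum_congr fun n => ?_
  have hind : ∀ x : ℕ → State d, ENNReal.ofReal (siteIndicator k i (x n).1 (x n).2) =
      ({x : ℕ → State d | x n = (-(k : ℤ), i)}).indicator 1 x := fun x => by
    by_cases h : x n = (-(k : ℤ), i)
    · rw [Set.indicator_of_mem (show x ∈ {x : ℕ → State d | x n = (-(k : ℤ), i)} from h), h]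
      simp [siteIndicator]
    · rw [Set.indicator_of_notMem (show x ∉ {x : ℕ → State d | x n = (-(k : ℤ), i)} from h)]
      unfold siteIndicator
      split_ifs with h1
      · rw [Pi.single_eq_of_ne fun h2 => h (Prod.ext h1 h2), ENNReal.ofReal_zero]
      · simp
  have hm := measurableSet_eq_at n (-(k : ℤ), i)
  simp only [hind]
  rw [lintegral_indicator_one hm, Measure.restrict_apply hm, Set.inter_comm]
  rfl

/-! ### The matrices `ζ_n` and the vectors `y_n` in typical environments -/

/-- The properties of an environment under which `ζ`, `y` and the density are well behaved. -/
structure Typical (ω : Env d) : Prop where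
  regular : ∀ n, (ω n).Regular
  exit_one : ∀ n, exitMatrix ω n *ᵥ 1 = 1
  blocks : HasPositiveBlocks (exitMatrix ω)

lemma ConditionC.ae_typical {Pr : Measure (Env d)} [IsFiniteMeasure Pr]
    (hC : ConditionC Pr) {μ : InitialLaw d}
    (htrans : ∀ᵐ p ∂annealed Pr μ, Tendsto (fun t => (p.2 t).1) atTop atTop) :
    ∀ᵐ ω ∂Pr, Typical ω := by
  filter_upwards [hC.ae_regular, hC.ae_exitMatrix_mulVec_one htrans, hC.ae_hasPositiveBlocks]
    with ω h1 h2 h3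
  exact ⟨h1, h2, h3⟩

lemma Typical.zeta_eq {ω : Env d} (h : Typical ω) : zeta ω = exitMatrix ω :=
  zeta_eq_exitMatrix h.regular h.exit_one

lemma Typical.isZeta {ω : Env d} (h : Typical ω) : IsZeta ω (zeta ω) := by
  rw [h.zeta_eq]
  exact isZeta_exitMatrix h.regular h.exit_one

lemma Typical.isBackwardLimit [Nonempty (Fin d)] {ω : Env d} (h : Typical ω) (n : ℤ) :
    IsBackwardLimit (exitMatrix ω) n (yvec ω n) := by
  rw [← h.zeta_eq]
  refine Classical.epsilon_spec (p := IsBackwardLimit (zeta ω) n) ?_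
  rw [h.zeta_eq]
  exact exists_isBackwardLimit (exitMatrix_nonneg ω) h.exit_one h.blocks n

lemma Typical.yvec_pos [Nonempty (Fin d)] {ω : Env d} (h : Typical ω) (n : ℤ) (j : Fin d) :
    0 < yvec ω n j :=
  (h.isBackwardLimit n).pos (exitMatrix_nonneg ω) h.exit_one (exitMatrix_col_pos h.regular) h.blocks j

/-- `yvec` is a choice, so equivariance rests on uniqueness of the backward limit. -/
lemma Typical.yvec_shift [Nonempty (Fin d)] {ω : Env d} (h : Typical ω) {m : ℤ}
    (hm : Typical (shift m ω)) (n : ℤ) : yvec (shift m ω) n = yvec ω (n + m) := by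
  refine (h.isBackwardLimit (n + m)).eq ?_ |>.symm
  intro u hu
  refine (hm.isBackwardLimit n u hu).congr fun k => ?_
  rw [backProd_eq_layerProd, backProd_eq_layerProd, layerProd_shift,
    show n - (k : ℤ) + m = n + m - k by ring]

lemma Typical.yvec_eq_vecMul [Nonempty (Fin d)] {ω : Env d} (h : Typical ω) (k : ℕ) :
    yvec ω (k - 1) = yvec ω (-1) ᵥ* layerProd (exitMatrix ω) 0 k := by
  induction k with
  | zero => simp [layerProd]
  | succ k ih =>
    have h1 := (h.isBackwardLimit ((k : ℤ) - 1)).vecMul (h.isBackwardLimit k)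
    rw [layerProd_succ', ← Matrix.vecMul_vecMul, ← ih, zero_add, ← h1]
    congr 1
    push_cast
    ring

lemma zetaProd_eq_layerProd (ω : Env d) (k : ℕ) : zetaProd ω k = layerProd (zeta ω) 0 k := by
  induction k with
  | zero => rfl
  | succ k ih => rw [zetaProd, ih, layerProd_succ', zero_add]

lemma Typical.AProd_mul_uTilde {ω : Env d} (h : Typical ω) (k : ℕ) :
    AProd ω k * uTilde ω 0 = excursionMatrix ω 0 k := by
  induction k with
  | zero => simp [AProd, uTilde, excursionMatrix, resolvent, h.zeta_eq]
  | succ k ih =>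
    rw [AProd, Matrix.mul_assoc, ih, excursionMatrix, zero_add, Amat, h.zeta_eq]
    rfl

lemma Typical.densityTerm_eq {ω : Env d} (h : Typical ω) (k : ℕ) :
    densityTerm ω k = layerProd (exitMatrix ω) 0 k * excursionMatrix ω 0 k := by
  rw [densityTerm, Matrix.mul_assoc, h.AProd_mul_uTilde, zetaProd_eq_layerProd, h.zeta_eq]

lemma Typical.densityTerm_nonneg {ω : Env d} (h : Typical ω) (k : ℕ) :
    ∀ i j, 0 ≤ densityTerm ω k i j := by
  rw [h.densityTerm_eq]
  exact mul_entry_nonneg (layerProd_nonneg (exitMatrix_nonneg ω) _ _)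
    (excursionMatrix_nonneg h.regular _ _)

/-- The choice $\mu_\omega=\mathbf y_{-1}$ enters here: the start vector in $\theta^k\omega$ is
$\mathbf y_{k-1}(\omega)=\mathbf y_{-1}\zeta_0\cdots\zeta_{k-1}$, which supplies the left factors of
the term. -/
lemma Typical.occupation_shift [Nonempty (Fin d)] {μ : InitialLaw d} {ω : Env d} (h : Typical ω)
    {k : ℕ} (hk : Typical (shift k ω))
    (ht : ∀ᵐ x ∂quenchedLaw μ (shift k ω), Tendsto (fun t => (x t).1) atTop atTop)
    (hμ : μ ω = yvec ω (-1)) (hμk : μ (shift k ω) = yvec (shift k ω) (-1)) (i : Fin d) :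
    occupation μ (shift k ω) (-k, i) = ENNReal.ofReal ((μ ω ᵥ* densityTerm ω k) i) := by
  rw [occupation_neg μ hk.regular ht, excursionMatrix_shift, neg_add_cancel, hμk,
    h.yvec_shift hk, show (-1 : ℤ) + k = k - 1 by ring, h.yvec_eq_vecMul, h.densityTerm_eq, hμ,
    Matrix.vecMul_vecMul]

/-! ### The environment viewed from the particle as a measure with density -/

/-- The expected occupation of height `i` in the environment viewed from the particle. -/
def totalOccupation (μ : InitialLaw d) (i : Fin d) (ω : Env d) : ℝ≥0∞ :=
  ∑' m : ℤ, occupation μ (shift (-m) ω) (m, i)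

lemma measurable_totalOccupation (μ : InitialLaw d) (i : Fin d) :
    Measurable (totalOccupation μ i) :=
  Measurable.tsum fun m => (measurable_occupation μ (m, i)).comp (measurable_shift (-m))

/-- Layers on the right of `0` are not visited before layer `1` is entered, so only `m = -k`
survives. -/
lemma totalOccupation_eq_tsum_nat (μ : InitialLaw d) (i : Fin d) (ω : Env d) :
    totalOccupation μ i ω = ∑' k : ℕ, occupation μ (shift k ω) (-k, i) := by
  have hinj : Function.Injective fun k : ℕ => -(k : ℤ) := fun a b h => by
    simpa using h
  have hsupp : Function.support (fun m : ℤ => occupation μ (shift (-m) ω) (m, i)) ⊆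
      Set.range fun k : ℕ => -(k : ℤ) := fun m hm => by
    by_contra hc
    refine hm (occupation_of_pos μ _ ?_)
    by_contra hle
    exact hc ⟨(-m).toNat, by simp only at hle ⊢; omega⟩
  rw [totalOccupation, ← hinj.tsum_eq hsupp]
  simp only [neg_neg]

lemma quenchedLaw_auxChain (μ : InitialLaw d) (ω : Env d) (B : Set (Env d)) (i : Fin d) (n : ℕ) :
    quenchedLaw μ ω {x | (n : ℕ∞) < hitTime 1 x ∧ shift (x n).1 ω ∈ B ∧ (x n).2 = i} =
      ∑' m : ℤ, B.indicator (fun _ => killedProb μ ω n (m, i)) (shift m ω) := by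
  classical
  have hU : {x : ℕ → State d | (n : ℕ∞) < hitTime 1 x ∧ shift (x n).1 ω ∈ B ∧ (x n).2 = i} =
      ⋃ m : ℤ, {x | shift m ω ∈ B ∧ (n : ℕ∞) < hitTime 1 x ∧ x n = (m, i)} := by
    ext x
    simp only [Set.mem_ofPred_eq, Set.mem_iUnion]
    constructor
    · rintro ⟨h1, h2, h3⟩
      exact ⟨(x n).1, h2, h1, Prod.ext rfl h3⟩
    · rintro ⟨m, h1, h2, h3⟩
      rw [h3]
      exact ⟨h2, h1, rfl⟩
  rw [hU, measure_iUnion]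
  · refine tsum_congr fun m => ?_
    by_cases h : shift m ω ∈ B
    · simp [h, killedProb]
    · simp [h]
  · intro a b hab
    refine Set.disjoint_left.2 fun x hx hx' => hab ?_
    exact congrArg Prod.fst (hx.2.2.symm.trans hx'.2.2)
  · intro m
    exact (MeasurableSet.const _).inter (measurableSet_killed n (m, i))

lemma annealed_apply (Pr : Measure (Env d)) [SFinite Pr] (μ : InitialLaw d)
    {S : Set (Env d × (ℕ → State d))} (hS : MeasurableSet S) :
    annealed Pr μ S = ∫⁻ ω, quenchedLaw μ ω (Prod.mk ω ⁻¹' S) ∂Pr :=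
  Measure.compProd_apply hS

lemma envMeasure_apply_eq_tsum (Pr : Measure (Env d)) (μ : InitialLaw d)
    {D : Set (Env d × Fin d)} (hD : MeasurableSet D) :
    envMeasure Pr μ D = speed Pr μ *
      ∑' n : ℕ, annealed Pr μ {p | (n : ℕ∞) < hitTime 1 p.2 ∧ auxChain n p ∈ D} := by
  rw [envMeasure, Measure.smul_apply, smul_eq_mul, Measure.sum_apply _ hD]
  congr 1
  refine tsum_congr fun n => ?_
  rw [Measure.map_apply (measurable_auxChain n) hD,
    Measure.restrict_apply (measurable_auxChain n hD), Set.inter_comm]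
  rfl

lemma envMeasureAt_apply (Pr : Measure (Env d)) (μ : InitialLaw d) (i : Fin d) {B : Set (Env d)}
    (hB : MeasurableSet B) : envMeasureAt Pr μ i B = envMeasure Pr μ (B ×ˢ {i}) := by
  rw [envMeasureAt, Measure.map_apply measurable_fst hB, Measure.restrict_apply (measurable_fst hB)]
  rfl

/-- Split the event at time `n` by the layer `m`, substitute by the measure-preserving shift so that
the indicator of `B` no longer depends on `m`, and exchange the sums over `n` and `m`. -/
lemma envMeasureAt_eq_withDensity {Pr : Measure (Env d)} [SFinite Pr]
    (h : Ergodic (shift 1) Pr) (μ : InitialLaw d) (i : Fin d) :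
    envMeasureAt Pr μ i = Pr.withDensity fun ω => speed Pr μ * totalOccupation μ i ω := by
  ext B hB
  have hBi : MeasurableSet (B ×ˢ {i} : Set (Env d × Fin d)) := hB.prod (measurableSet_singleton i)
  have hk : ∀ n m, Measurable fun ω : Env d => killedProb μ (shift (-m) ω) n (m, i) := fun n m =>
    (measurable_killedProb μ n (m, i)).comp (measurable_shift (-m))
  have hn : ∀ n : ℕ, annealed Pr μ
      {p | (n : ℕ∞) < hitTime 1 p.2 ∧ auxChain n p ∈ (B ×ˢ {i} : Set (Env d × Fin d))} =
      ∑' m : ℤ, ∫⁻ ω in B, killedProb μ (shift (-m) ω) n (m, i) ∂Pr := fun n => by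
    have hS : MeasurableSet {p : Env d × (ℕ → State d) |
        (n : ℕ∞) < hitTime 1 p.2 ∧ auxChain n p ∈ (B ×ˢ {i} : Set (Env d × Fin d))} :=
      (measurableSet_lt_hitTime 1 n).inter (measurable_auxChain n hBi)
    rw [annealed_apply Pr μ hS]
    have e : ∀ ω, quenchedLaw μ ω (Prod.mk ω ⁻¹' {p | (n : ℕ∞) < hitTime 1 p.2 ∧
        auxChain n p ∈ (B ×ˢ {i} : Set (Env d × Fin d))}) =
        ∑' m : ℤ, B.indicator (fun _ => killedProb μ ω n (m, i)) (shift m ω) := fun ω =>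
      quenchedLaw_auxChain μ ω B i n
    rw [lintegral_congr e, lintegral_tsum]
    · refine tsum_congr fun m => ?_
      rw [← lintegral_indicator hB,
        ← (measurePreserving_shift h m).lintegral_comp ((hk n m).indicator hB)]
      refine lintegral_congr fun ω => ?_
      by_cases hω : shift m ω ∈ B
      · simp [hω, shift_shift, shift_zero]
      · simp [hω]
    · intro m
      exact ((measurable_killedProb μ n (m, i)).indicator (measurable_shift m hB)).aemeasurable
  rw [envMeasureAt_apply Pr μ i hB, envMeasure_apply_eq_tsum Pr μ hBi, withDensity_apply _ hB,
    lintegral_const_mul _ (measurable_totalOccupation μ i), tsum_congr hn, ENNReal.tsum_comm]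
  congr 1
  have ho : ∀ m : ℤ, Measurable fun ω : Env d => occupation μ (shift (-m) ω) (m, i) := fun m =>
    (measurable_occupation μ (m, i)).comp (measurable_shift (-m))
  unfold totalOccupation
  rw [lintegral_tsum fun m => (ho m).aemeasurable]
  refine tsum_congr fun m => ?_
  unfold occupation
  rw [lintegral_tsum fun n => (hk n m).aemeasurable]

lemma envMeasureTotal_eq_sum (Pr : Measure (Env d)) (μ : InitialLaw d) :
    envMeasureTotal Pr μ = ∑ i, envMeasureAt Pr μ i := by
  ext B hB
  have h := sum_measure_preimage_singleton (μ := (envMeasure Pr μ).restrict (Prod.fst ⁻¹' B))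
    (Finset.univ : Finset (Fin d)) (f := Prod.snd)
    (fun y _ => measurable_snd (measurableSet_singleton y))
  rw [Finset.coe_univ, Set.preimage_univ, Measure.restrict_apply_univ] at h
  rw [envMeasureTotal, Measure.map_apply measurable_fst hB, ← h, Measure.finsetSum_apply]
  refine Finset.sum_congr rfl fun i _ => ?_
  rw [envMeasureAt_apply Pr μ i hB,
    Measure.restrict_apply (measurable_snd (measurableSet_singleton i)), Set.inter_comm]
  rfl

/-! ### Mass bounds from the mean hitting time -/

lemma tsum_lt_coe_le (T : ℕ∞) :
    ∑' n : ℕ, (if (n : ℕ∞) < T then (1 : ℝ≥0∞) else 0) ≤ (T : ℝ≥0∞) := by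
  induction T using ENat.recTopCoe with
  | top => simp
  | coe N =>
    rw [tsum_eq_sum (s := Finset.range N) fun n hn => by simpa using hn]
    refine (Finset.sum_le_card_nsmul _ _ 1 fun n _ => ?_).trans ?_
    · split_ifs <;> simp
    · simp

lemma tsum_annealed_le_meanHitTime (Pr : Measure (Env d)) (μ : InitialLaw d) :
    ∑' n : ℕ, annealed Pr μ {p | (n : ℕ∞) < hitTime 1 p.2} ≤ meanHitTime Pr μ := by
  have h : ∀ n : ℕ, annealed Pr μ {p | (n : ℕ∞) < hitTime 1 p.2} =
      ∫⁻ p, (if (n : ℕ∞) < hitTime 1 p.2 then 1 else 0) ∂annealed Pr μ := fun n => by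
    rw [← lintegral_indicator_one (measurableSet_lt_hitTime 1 n)]
    refine lintegral_congr fun p => ?_
    simp only [Set.indicator_apply, Set.mem_ofPred_eq, Pi.one_apply]
  rw [tsum_congr h, ← lintegral_tsum fun n => (Measurable.ite (measurableSet_lt_hitTime 1 n)
    measurable_const measurable_const).aemeasurable]
  exact lintegral_mono fun p => tsum_lt_coe_le _

/-- The walk starts in layer `0`, so the time-zero term alone has mass `1`. This keeps the speed
finite, as its conversion to a real number requires. -/
lemma one_le_meanHitTime (Pr : Measure (Env d)) [IsProbabilityMeasure Pr] (μ : InitialLaw d) :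
    1 ≤ meanHitTime Pr μ := by
  refine le_trans ?_ (tsum_annealed_le_meanHitTime Pr μ)
  refine le_trans ?_ (ENNReal.le_tsum 0)
  rw [annealed_apply Pr μ (measurableSet_lt_hitTime 1 0)]
  have h : ∀ ω, quenchedLaw μ ω (Prod.mk ω ⁻¹' {p | ((0 : ℕ) : ℕ∞) < hitTime 1 p.2}) = 1 :=
    fun ω => by
    refine (mem_ae_iff_prob_eq_one (measurableSet_lt_hitTime' 1 0)).1 ?_
    filter_upwards [ae_start μ ω] with x hx
    refine (lt_hitTime_iff 1 x 0).2 fun t ht => ?_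
    rw [Nat.le_zero.1 ht, hx]
    exact zero_ne_one
  rw [lintegral_congr h]
  simp

lemma speed_ne_top (Pr : Measure (Env d)) [IsProbabilityMeasure Pr] (μ : InitialLaw d) :
    speed Pr μ ≠ ⊤ :=
  ENNReal.inv_ne_top.2 (one_pos.trans_le (one_le_meanHitTime Pr μ)).ne'

lemma envMeasure_univ_le (Pr : Measure (Env d)) (μ : InitialLaw d) :
    envMeasure Pr μ Set.univ ≤ 1 := by
  rw [envMeasure_apply_eq_tsum Pr μ MeasurableSet.univ]
  simp only [Set.mem_univ, and_true]
  exact (mul_le_mul_right (tsum_annealed_le_meanHitTime Pr μ) _).trans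
    (ENNReal.inv_mul_le_one _)

/-- The density of `envMeasureAt` has integral at most `1`, hence is a.e. finite; positivity of the
speed passes finiteness to the occupation. -/
lemma ae_totalOccupation_lt_top {Pr : Measure (Env d)} [IsProbabilityMeasure Pr]
    (h : Ergodic (shift 1) Pr) {μ : InitialLaw d} (hv : 0 < speed Pr μ) (i : Fin d) :
    ∀ᵐ ω ∂Pr, totalOccupation μ i ω < ⊤ := by
  have hfin : ∫⁻ ω, speed Pr μ * totalOccupation μ i ω ∂Pr ≠ ⊤ := by
    have h1 : envMeasureAt Pr μ i Set.univ ≤ 1 := by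
      rw [envMeasureAt_apply Pr μ i MeasurableSet.univ]
      exact (measure_mono (Set.subset_univ _)).trans (envMeasure_univ_le Pr μ)
    rw [envMeasureAt_eq_withDensity h, withDensity_apply _ MeasurableSet.univ,
      Measure.restrict_univ] at h1
    exact (h1.trans_lt ENNReal.one_lt_top).ne
  filter_upwards [ae_lt_top ((measurable_totalOccupation μ i).const_mul _) hfin] with ω hω
  by_contra hc
  rw [not_lt_top_iff.1 hc, ENNReal.mul_top hv.ne'] at hω
  exact lt_irrefl _ hω

/-! ### Identification of the density -/

lemma summable_of_tsum_ofReal {f : ℕ → ℝ} (hf : ∀ k, 0 ≤ f k)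
    (h : ∑' k, ENNReal.ofReal (f k) ≠ ⊤) : Summable f := by
  have := ENNReal.summable_toReal h
  simpa only [ENNReal.toReal_ofReal (hf _)] using this

/-- By positivity of `u`, each entry `D k i j` is at most `(u i)⁻¹` times the summable `(u ᵥ* D k)
j`. -/
lemma summable_of_vecMul {u : Fin d → ℝ} (hu : ∀ j, 0 < u j) {D : ℕ → Matrix (Fin d) (Fin d) ℝ}
    (hD : ∀ k i j, 0 ≤ D k i j) (h : ∀ j, Summable fun k => (u ᵥ* D k) j) : Summable D := by
  refine Pi.summable.2 fun i => Pi.summable.2 fun j => ?_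
  refine Summable.of_nonneg_of_le (fun k => hD k i j) (fun k => ?_) ((h j).mul_left (u i)⁻¹)
  rw [le_inv_mul_iff₀ (hu i)]
  exact Finset.single_le_sum (f := fun l => u l * D k l j)
    (fun l _ => mul_nonneg (hu l).le (hD k l j)) (Finset.mem_univ i)

lemma vecMul_tsum {D : ℕ → Matrix (Fin d) (Fin d) ℝ} (hD : Summable D) (u : Fin d → ℝ)
    (j : Fin d) : (u ᵥ* ∑' k, D k) j = ∑' k, (u ᵥ* D k) j := by
  have h1 : ∀ l, HasSum (fun k => D k l j) ((∑' k, D k) l j) := fun l =>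
    Pi.hasSum.1 (Pi.hasSum.1 hD.hasSum l) j
  have h2 : HasSum (fun k => ∑ l, u l * D k l j) (∑ l, u l * (∑' k, D k) l j) :=
    hasSum_sum fun l _ => (h1 l).mul_left (u l)
  exact h2.tsum_eq.symm

/-- Joins the probabilistic and the algebraic density. Summability must come first: otherwise the
matrix `tsum` takes its default value and does not commute with multiplication by the row vector. -/
lemma ae_density_spec {Pr : Measure (Env d)} [IsProbabilityMeasure Pr] (hd : 1 ≤ d)
    (hC : ConditionC Pr) {μ : InitialLaw d} (hμ : ∀ᵐ ω ∂Pr, μ ω = yvec ω (-1))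
    (htrans : ∀ᵐ p ∂annealed Pr μ, Tendsto (fun t => (p.2 t).1) atTop atTop)
    (hv : 0 < speed Pr μ) :
    ∀ᵐ ω ∂Pr, Summable (densityTerm ω) ∧ ∀ i, 0 ≤ densityAt Pr μ i ω ∧
      speed Pr μ * totalOccupation μ i ω = ENNReal.ofReal (densityAt Pr μ i ω) := by
  have : Nonempty (Fin d) := ⟨⟨0, hd⟩⟩
  -- The $k$-th term involves $\theta^k\omega$, so almost sure properties are needed along the whole
  -- forward orbit.
  have hall : ∀ {p : Env d → Prop}, (∀ᵐ ω ∂Pr, p ω) → ∀ᵐ ω ∂Pr, ∀ k : ℕ, p (shift k ω) :=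
    fun h => ae_all_iff.2 fun k =>
      (measurePreserving_shift hC.ergodic k).quasiMeasurePreserving.ae h
  filter_upwards [hC.ae_typical htrans, hall (hC.ae_typical htrans), hμ, hall hμ,
    hall (ae_quenched_transient htrans),
    ae_all_iff.2 (ae_totalOccupation_lt_top hC.ergodic hv)] with ω h hk hm hmk ht hfin
  have hocc : ∀ i, totalOccupation μ i ω =
      ∑' k, ENNReal.ofReal ((μ ω ᵥ* densityTerm ω k) i) := fun i => by
    rw [totalOccupation_eq_tsum_nat]
    exact tsum_congr fun k => h.occupation_shift (hk k) (ht k) hm (hmk k) i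
  have hnn : ∀ i k, 0 ≤ (μ ω ᵥ* densityTerm ω k) i := fun i k =>
    Finset.sum_nonneg (s := Finset.univ) (f := fun j => μ ω j * densityTerm ω k j i) fun j _ =>
      mul_nonneg ((μ.mem_simplex ω).1 j) (h.densityTerm_nonneg k j i)
  have hsum : ∀ i, Summable fun k => (μ ω ᵥ* densityTerm ω k) i := fun i =>
    summable_of_tsum_ofReal (hnn i) (by rw [← hocc]; exact (hfin i).ne)
  have hS : Summable (densityTerm ω) := by
    refine summable_of_vecMul (fun j => ?_) h.densityTerm_nonneg hsum
    rw [hm]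
    exact h.yvec_pos (-1) j
  refine ⟨hS, fun i => ?_⟩
  rw [densityAt, vecMul_tsum hS, hocc, ENNReal.ofReal_mul ENNReal.toReal_nonneg,
    ENNReal.ofReal_toReal (speed_ne_top Pr μ), ENNReal.ofReal_tsum_of_nonneg (hnn i) (hsum i)]
  exact ⟨mul_nonneg ENNReal.toReal_nonneg (tsum_nonneg (hnn i)), rfl⟩

lemma density_eq_sum (Pr : Measure (Env d)) (μ : InitialLaw d) (ω : Env d) :
    density Pr μ ω = ∑ i, densityAt Pr μ i ω := by
  simp only [density, densityAt, ← Finset.mul_sum, dotProduct_one]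

end StripRWRE

end

theorem theorem3 {d : ℕ} (hd : 1 ≤ d)
    (Pr : Measure (StripRWRE.Env d)) [IsProbabilityMeasure Pr]
    (hC : StripRWRE.ConditionC Pr)
    (μ : StripRWRE.InitialLaw d)
    (hμ : ∀ᵐ ω ∂Pr, μ ω = StripRWRE.yvec ω (-1))
    (htrans : ∀ᵐ p ∂(StripRWRE.annealed Pr μ), Tendsto (fun t => (p.2 t).1) atTop atTop)
    (hv : 0 < StripRWRE.speed Pr μ) :
    -- the matrices `ζ_n`, the vectors `y_n` and the matrix series are well defined
    (∀ᵐ ω ∂Pr,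
      (StripRWRE.IsZeta ω (StripRWRE.zeta ω) ∧
        ∀ ζ, StripRWRE.IsZeta ω ζ → ζ = StripRWRE.zeta ω) ∧
      (∀ n : ℤ, StripRWRE.IsBackwardLimit (StripRWRE.zeta ω) n (StripRWRE.yvec ω n)) ∧
      Summable (StripRWRE.densityTerm ω)) ∧
    -- absolute continuity and density of `Q_i`
    (∀ i : Fin d, StripRWRE.envMeasureAt Pr μ i ≪ Pr ∧
      (StripRWRE.envMeasureAt Pr μ i).rnDeriv Pr =ᵐ[Pr]
        fun ω => ENNReal.ofReal (StripRWRE.densityAt Pr μ i ω)) ∧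
    -- absolute continuity and density of the environment marginal of `Q`
    (StripRWRE.envMeasureTotal Pr μ ≪ Pr ∧
      (StripRWRE.envMeasureTotal Pr μ).rnDeriv Pr =ᵐ[Pr]
        fun ω => ENNReal.ofReal (StripRWRE.density Pr μ ω)) := by
  have : Nonempty (Fin d) := ⟨⟨0, hd⟩⟩
  have hspec := StripRWRE.ae_density_spec hd hC hμ htrans hv
  have hmeas : ∀ i, Measurable fun ω =>
      StripRWRE.speed Pr μ * StripRWRE.totalOccupation μ i ω := fun i =>
    (StripRWRE.measurable_totalOccupation μ i).const_mul _
  refine ⟨?_, fun i => ?_, ?_⟩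
  · filter_upwards [hC.ae_typical htrans, hspec] with ω h hω
    refine ⟨⟨h.isZeta, fun ζ hζ => ?_⟩, fun n => ?_, hω.1⟩
    · rw [h.zeta_eq]
      exact hζ.eq_exitMatrix h.exit_one
    · rw [h.zeta_eq]
      exact h.isBackwardLimit n
  · rw [StripRWRE.envMeasureAt_eq_withDensity hC.ergodic]
    refine ⟨withDensity_absolutelyContinuous _ _,
      (Measure.rnDeriv_withDensity Pr (hmeas i)).trans ?_⟩
    filter_upwards [hspec] with ω hω
    exact (hω.2 i).2
  -- The density is summed over heights in `ℝ≥0∞`; it becomes one real density only at the end,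
  -- using nonnegativity of every `densityAt`.
  · have hsum : StripRWRE.envMeasureTotal Pr μ = Pr.withDensity fun ω =>
        ∑ i, StripRWRE.speed Pr μ * StripRWRE.totalOccupation μ i ω := by
      rw [StripRWRE.envMeasureTotal_eq_sum]
      ext B hB
      rw [Measure.finsetSum_apply, withDensity_apply _ hB,
        lintegral_finsetSum _ fun i _ => hmeas i]
      refine Finset.sum_congr rfl fun i _ => ?_
      rw [StripRWRE.envMeasureAt_eq_withDensity hC.ergodic, withDensity_apply _ hB]
    rw [hsum]
    refine ⟨withDensity_absolutelyContinuous _ _,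
      (Measure.rnDeriv_withDensity Pr (Finset.measurable_fun_sum _ fun i _ => hmeas i)).trans ?_⟩
    filter_upwards [hspec] with ω hω
    rw [StripRWRE.density_eq_sum, ENNReal.ofReal_sum_of_nonneg fun i _ => (hω.2 i).1]
    exact Finset.sum_congr rfl fun i _ => (hω.2 i).2
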